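/- Let $\mathsf W,\mathsf X,\mathsf Y$ be standard Borel spaces, $P_W$ a probability measure on $\mathsf W$, and $w\mapsto P_{Z|w}$ a Markov kernel from $\mathsf W$ to $\mathsf Z=\mathsf X\times\mathsf Y$. Let $W$, $Z^n=(Z_1,\dots,Z_n)$ with $Z_i=(X_i,Y_i)$, and $Z=(X,Y)$ be random elements with joint law $$P_{W,Z^n,Z}=P_W\Big(\prod_{i=1}^n P_{Z_i|W}\Big)P_{Z|W},\qquad P_{Z_i|W}=P_{Z|W},$$ and write $X^n=(X_1,\dots,X_n)$, $Y^n=(Y_1,\dots,Y_n)$. Mutual informations are defined by Kullback--Leibler divergence and take values in $[0,\infty]$: $I(U;V)=D_{\rm KL}(P_{U,V}\|P_U\otimes P_V)$ and $I(U;V|T)=D_{\rm KL}\big(P_{T,U,V}\,\big\|\,P_T(P_{U|T}\otimes P_{V|T})\big)$. For a $\sigma$-finite measure $\mu$ on $\mathsf Y$, let the action space be the set of probability densities $q:\mathsf Y\to[0,\infty)$ with respect to $\mu$, and let the log loss be $\ell(y,q)=-\log q(y)\in(-\infty,+\infty]$. For a random element $V$, let $R_{\log}(Y|V)=\inf_{\psi}\mathbb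 E[-\log\psi(V)(Y)]\in[-\infty,+\infty]$, the infimum being over all decision rules $\psi$ such that $(v,y)\mapsto\psi(v)(y)$ is measurable and the expectation is defined (the positive and negative parts of the loss do not both have infinite expectation). The minimum excess risk is $${\rm MER}_{\log}=R_{\log}(Y|X,Z^n)-R_{\log}(Y|X,W).$$ (a) Let $n\ge 0$ and suppose that $P_{Y|X=x,W=w}$ has a density with respect to $\mu$ for $P_{X,W}$-almost every $(x,w)$, and that the difference defining ${\rm MER}_{\log}$ is not of the form $\infty-\infty$ or $(-\infty)-(-\infty)$. Then $${\rm MER}_{\log}=I(W;Y|X,Z^n).$$ (b) For every $n\ge1$ (with no assumption on the existence of densities), $$I(W;Y|X,Z^n)\le\frac1n I(W;Y^n|X^n)\qquad\text{and}\qquad I(W;Y|X,Z^n)\le\frac1n I(W;Z^n).$$ -/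

import Mathlib

open MeasureTheory ProbabilityTheory
open scoped ENNReal NNReal

namespace BayesLearning

noncomputable section

/-- The kernel sending `w` to the law `P_{Z|w}^{⊗ n}` of `n` i.i.d. samples from `κ w = P_{Z|w}`. -/
def iidKernel {𝓦 𝓩 : Type*} [MeasurableSpace 𝓦] [MeasurableSpace 𝓩]
    (κ : Kernel 𝓦 𝓩) [IsMarkovKernel κ] (n : ℕ) : Kernel 𝓦 (Fin n → 𝓩) where
  toFun w := Measure.pi (fun _ : Fin n => κ w)
  measurable' := by
    refine Measurable.measure_of_isPiSystem_of_isProbabilityMeasure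
      generateFrom_pi.symm isPiSystem_pi ?_
    rintro s ⟨t, ht, rfl⟩
    simp only [Measure.pi_pi]
    exact Finset.measurable_prod _ fun i _ => κ.measurable_coe (ht i (Set.mem_univ i))

instance {𝓦 𝓩 : Type*} [MeasurableSpace 𝓦] [MeasurableSpace 𝓩]
    (κ : Kernel 𝓦 𝓩) [IsMarkovKernel κ] (n : ℕ) : IsMarkovKernel (iidKernel κ n) :=
  ⟨fun w => inferInstanceAs (IsProbabilityMeasure (Measure.pi (fun _ : Fin n => κ w)))⟩

/-- The joint law `P_W (∏ᵢ P_{Zᵢ|W}) P_{Z|W}` of `(W, Zⁿ, Z)`: the parameter `W` has law `prior`,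
and the data `Zⁿ` and the fresh sample `Z` are conditionally i.i.d. from `κ W` given `W`. -/
def jointLaw {𝓦 𝓩 : Type*} [MeasurableSpace 𝓦] [MeasurableSpace 𝓩]
    (prior : Measure 𝓦) (κ : Kernel 𝓦 𝓩) [IsMarkovKernel κ] (n : ℕ) :
    Measure (𝓦 × ((Fin n → 𝓩) × 𝓩)) :=
  prior ⊗ₘ (iidKernel κ n ×ₖ κ)

/-- The expectation of `f` is defined: its positive and negative parts do not both have
infinite expectation. -/
def ExpectationDefined {Ω : Type*} [MeasurableSpace Ω] (P : Measure Ω) (f : Ω → EReal) : Prop :=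
  ∫⁻ ω, (f ω).toENNReal ∂P ≠ ∞ ∨ ∫⁻ ω, (-f ω).toENNReal ∂P ≠ ∞

/-- The extended expectation `E[f⁺] - E[f⁻]`, meaningful when `ExpectationDefined P f`. -/
def expectation {Ω : Type*} [MeasurableSpace Ω] (P : Measure Ω) (f : Ω → EReal) : EReal :=
  ((∫⁻ ω, (f ω).toENNReal ∂P : ℝ≥0∞) : EReal) - ((∫⁻ ω, (-f ω).toENNReal ∂P : ℝ≥0∞) : EReal)

/-- The Bayes risk `R_ℓ(Y|V) = inf_ψ E[ℓ(Y, ψ(V))]` of predicting `Y` from `V`. The infimum is over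
all decision rules `ψ` for which `(v, y) ↦ ℓ(y, ψ(v))` is measurable and the expectation is
defined. -/
def bayesRisk {Ω 𝓥 𝓨 𝓐 : Type*} [MeasurableSpace Ω] [MeasurableSpace 𝓥] [MeasurableSpace 𝓨]
    (P : Measure Ω) (ℓ : 𝓨 → 𝓐 → EReal) (Y : Ω → 𝓨) (V : Ω → 𝓥) : EReal :=
  ⨅ (ψ : 𝓥 → 𝓐) (_ : Measurable fun p : 𝓥 × 𝓨 => ℓ p.2 (ψ p.1))
    (_ : ExpectationDefined P fun ω => ℓ (Y ω) (ψ (V ω))),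
    expectation P fun ω => ℓ (Y ω) (ψ (V ω))

/-- The minimum excess risk `MER_ℓ = R_ℓ(Y|X,Zⁿ) - R_ℓ(Y|X,W)`. -/
def minExcessRisk {Ω 𝓦 𝓧 𝓨 𝓓 𝓐 : Type*} [MeasurableSpace Ω] [MeasurableSpace 𝓦]
    [MeasurableSpace 𝓧] [MeasurableSpace 𝓨] [MeasurableSpace 𝓓]
    (P : Measure Ω) (ℓ : 𝓨 → 𝓐 → EReal) (W : Ω → 𝓦) (X : Ω → 𝓧) (Y : Ω → 𝓨) (D : Ω → 𝓓) :
    EReal :=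
  bayesRisk P ℓ Y (fun ω => (X ω, D ω)) - bayesRisk P ℓ Y (fun ω => (X ω, W ω))

/-- Probability densities with respect to `μ`. -/
structure ProbDensity {𝓨 : Type*} [MeasurableSpace 𝓨] (μ : Measure 𝓨) where
  toFun : 𝓨 → ℝ≥0
  measurable_toFun : Measurable toFun
  lintegral_eq_one : ∫⁻ y, (toFun y : ℝ≥0∞) ∂μ = 1

/-- The log loss `ℓ(y, q) = -log q(y)`, equal to `+∞` where `q(y) = 0`. -/
def logLoss {𝓨 : Type*} [MeasurableSpace 𝓨] (μ : Measure 𝓨) (y : 𝓨) (q : ProbDensity μ) : EReal :=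
  -ENNReal.log (q.toFun y : ℝ≥0∞)

/-- The mutual information `I(U;V) = D_KL(P_{U,V} ‖ P_U × P_V)`. -/
def mutualInfo {Ω 𝓤 𝓥 : Type*} [MeasurableSpace Ω] [MeasurableSpace 𝓤] [MeasurableSpace 𝓥]
    (P : Measure Ω) (U : Ω → 𝓤) (V : Ω → 𝓥) : ℝ≥0∞ :=
  InformationTheory.klDiv (P.map fun ω => (U ω, V ω)) ((P.map U).prod (P.map V))

/-- The conditional mutual information
`I(U;V|T) = D_KL(P_{T,U,V} ‖ P_T (P_{U|T} × P_{V|T})) = E[D_KL(P_{U,V|T} ‖ P_{U|T} × P_{V|T})]`. -/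
def condMutualInfo {Ω 𝓤 𝓥 𝓣 : Type*} [MeasurableSpace Ω]
    [MeasurableSpace 𝓤] [StandardBorelSpace 𝓤] [Nonempty 𝓤]
    [MeasurableSpace 𝓥] [StandardBorelSpace 𝓥] [Nonempty 𝓥] [MeasurableSpace 𝓣]
    (P : Measure Ω) [IsFiniteMeasure P] (U : Ω → 𝓤) (V : Ω → 𝓥) (T : Ω → 𝓣) : ℝ≥0∞ :=
  InformationTheory.klDiv (P.map fun ω => (T ω, (U ω, V ω)))
    ((P.map T) ⊗ₘ (condDistrib U T P ×ₖ condDistrib V T P))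

end

end BayesLearning

-- Rate bounds. The chain rule gives I(W;Yⁿ|Xⁿ) = ∑ᵢ I(W;Yᵢ | Xⁿ, Y^{<i}), so it suffices to bound
-- I(W;Y|X,Zⁿ) by each summand. Given W, the samples and the fresh pair are i.i.d., hence exchanging
-- Zᵢ with Z preserves the joint law, and the i-th summand equals I(W;Y | S), where S consists of Xⁿ
-- with Xᵢ replaced by X, together with Y^{<i}. Now S is a function of (X,Zⁿ), and given (S,W) the
-- law of Y is P_{Y|X,W}, so Y is independent of (X,Zⁿ). Expanding I(Y; W,(X,Zⁿ) | S) in both orders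
-- shows that passing from S to (X,Zⁿ) cannot increase the information
-- (`condMutualInfo_le_of_condIndep`). The second bound adds I(W;Zⁿ) = I(W;Xⁿ) + I(W;Yⁿ|Xⁿ).
--
-- Log loss. Domination of P_{Y|X,W} by μ passes to P_{Y|X,Zⁿ} when W is integrated out, so both
-- laws have jointly measurable densities p and q. By Gibbs' inequality the true conditional density
-- is the optimal rule (`bayesRisk_logLoss`), and the excess risk becomes E[log(p/q)]. Since
-- P_{Y|X,Zⁿ,W} = P_{Y|X,W}, this is the divergence of P_{X,Zⁿ,W,Y} from P_{X,Zⁿ,W} P_{Y|X,Zⁿ}, that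
-- is, I(W;Y|X,Zⁿ).
--
-- Risks may be infinite, so logarithms are split into positive and negative parts in [0,∞] and all
-- identities are written without subtraction (`ExcessLossParts`). The bound E[log⁺(q/p)] ≤ E[q/p] ≤
-- 1 is what excludes indeterminate forms in the divergence.

open InformationTheory

namespace BayesLearning

-- Invariance of the divergence and rearrangement of composition products

section KullbackLeibler

variable {α β : Type*} [MeasurableSpace α] [MeasurableSpace β]

/-- Data processing along `f`, then along `g`, gives the two inequalities. -/
lemma klDiv_map_of_leftInverse {μ ν : Measure α} [IsFiniteMeasure μ] [IsFiniteMeasure ν]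
    {f : α → β} {g : β → α} (hf : Measurable f) (hg : Measurable g)
    (hgf : Function.LeftInverse g f) :
    klDiv (μ.map f) (ν.map f) = klDiv μ ν := by
  refine le_antisymm (klDiv_map_le μ ν hf) ?_
  have h := klDiv_map_le (μ.map f) (ν.map f) hg
  rwa [Measure.map_map hg hf, Measure.map_map hg hf, hgf.comp_eq_id, Measure.map_id,
    Measure.map_id] at h

end KullbackLeibler

section CompProd

variable {𝓣 𝓤 𝓥 𝓡 : Type*} [MeasurableSpace 𝓣] [MeasurableSpace 𝓤] [MeasurableSpace 𝓥]
  [MeasurableSpace 𝓡]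

lemma compProd_prod_map_assoc (ρ : Measure 𝓣) [SFinite ρ]
    (κ : Kernel 𝓣 𝓤) [IsSFiniteKernel κ] (η : Kernel 𝓣 𝓥) [IsSFiniteKernel η] :
    (ρ ⊗ₘ (κ ×ₖ η)).map (fun p => ((p.1, p.2.1), p.2.2)) = (ρ ⊗ₘ κ) ⊗ₘ η.prodMkRight 𝓤 := by
  refine Measure.ext_of_lintegral _ fun f hf => ?_
  rw [lintegral_map hf (by fun_prop), Measure.lintegral_compProd (by fun_prop),
    Measure.lintegral_compProd hf, Measure.lintegral_compProd (by fun_prop)]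
  refine lintegral_congr fun t => ?_
  rw [Kernel.lintegral_prod _ _ _ (by fun_prop)]
  simp

lemma compProd_prod_map_swap (ρ : Measure 𝓣) [SFinite ρ]
    (κ : Kernel 𝓣 𝓤) [IsSFiniteKernel κ] (η : Kernel 𝓣 𝓥) [IsSFiniteKernel η] :
    (ρ ⊗ₘ (κ ×ₖ η)).map (fun p => (p.1, (p.2.2, p.2.1))) = ρ ⊗ₘ (η ×ₖ κ) := by
  refine Measure.ext_of_lintegral _ fun f hf => ?_
  rw [lintegral_map hf (by fun_prop), Measure.lintegral_compProd (by fun_prop),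
    Measure.lintegral_compProd hf]
  refine lintegral_congr fun t => ?_
  rw [Kernel.lintegral_prod_symm _ _ _ (by fun_prop), Kernel.lintegral_prod _ _ _ (by fun_prop)]

lemma compProd_compProd_prodMkRight_map (ρ : Measure (𝓣 × 𝓤)) [SFinite ρ]
    (κ : Kernel 𝓣 𝓥) [IsSFiniteKernel κ] (η : Kernel (𝓣 × 𝓥) 𝓡) [IsSFiniteKernel η] :
    (ρ ⊗ₘ (κ ⊗ₖ η).prodMkRight 𝓤).map (fun p => ((p.1, p.2.1), p.2.2)) =
      (ρ ⊗ₘ κ.prodMkRight 𝓤) ⊗ₘ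
        η.comap (fun q : (𝓣 × 𝓤) × 𝓥 => (q.1.1, q.2)) (by fun_prop) := by
  refine Measure.ext_of_lintegral _ fun f hf => ?_
  rw [lintegral_map hf (by fun_prop), Measure.lintegral_compProd (by fun_prop),
    Measure.lintegral_compProd hf, Measure.lintegral_compProd (by fun_prop)]
  refine lintegral_congr fun t => ?_
  rw [Kernel.lintegral_prodMkRight, Kernel.lintegral_prodMkRight,
    Kernel.lintegral_compProd _ _ _ (by fun_prop)]
  simp

end CompProd

-- Calculus of conditional mutual information

section CondMutualInfo

variable {Ω 𝓤 𝓥 𝓣 𝓡 : Type*} [MeasurableSpace Ω]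
  [MeasurableSpace 𝓤] [StandardBorelSpace 𝓤] [Nonempty 𝓤]
  [MeasurableSpace 𝓥] [StandardBorelSpace 𝓥] [Nonempty 𝓥]
  [MeasurableSpace 𝓣] [MeasurableSpace 𝓡]
  {P : Measure Ω} [IsProbabilityMeasure P] {U : Ω → 𝓤} {V : Ω → 𝓥} {T : Ω → 𝓣}

lemma map_prodMk_eq_compProd_condDistrib (hV : Measurable V) :
    P.map (fun ω => (T ω, V ω)) = P.map T ⊗ₘ condDistrib V T P :=
  (compProd_map_condDistrib hV.aemeasurable).symm

/-- Conditional laws are almost everywhere unique, so any version may replace `condDistrib`. -/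
lemma condMutualInfo_eq_of_kernel (hU : Measurable U) (hV : Measurable V)
    {κ : Kernel 𝓣 𝓤} [IsMarkovKernel κ] {η : Kernel 𝓣 𝓥} [IsMarkovKernel η]
    (hκ : P.map (fun ω => (T ω, U ω)) = P.map T ⊗ₘ κ)
    (hη : P.map (fun ω => (T ω, V ω)) = P.map T ⊗ₘ η) :
    condMutualInfo P U V T =
      klDiv (P.map fun ω => (T ω, (U ω, V ω))) (P.map T ⊗ₘ (κ ×ₖ η)) := by
  rw [condMutualInfo]
  congr 1
  refine Measure.compProd_congr ?_
  filter_upwards [condDistrib_ae_eq_of_measure_eq_compProd T hU.aemeasurable hκ,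
    condDistrib_ae_eq_of_measure_eq_compProd T hV.aemeasurable hη] with t h1 h2
  rw [Kernel.prod_apply, Kernel.prod_apply, h1, h2]

/-- The asymmetric form: P_T (P_{U|T} × P_{V|T}) is P_{T,U} followed by a kernel that ignores U.
Both the chain rule and the log-loss identity use this form. -/
lemma condMutualInfo_eq_klDiv_compProd (hU : Measurable U) (hV : Measurable V)
    (hT : Measurable T) {η : Kernel 𝓣 𝓥} [IsMarkovKernel η]
    (hη : P.map (fun ω => (T ω, V ω)) = P.map T ⊗ₘ η) :
    condMutualInfo P U V T =
      klDiv (P.map fun ω => ((T ω, U ω), V ω))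
        (P.map (fun ω => (T ω, U ω)) ⊗ₘ η.prodMkRight 𝓤) := by
  have : IsProbabilityMeasure (P.map T) := Measure.isProbabilityMeasure_map hT.aemeasurable
  have hκ := map_prodMk_eq_compProd_condDistrib (P := P) (T := T) hU
  rw [condMutualInfo_eq_of_kernel hU hV hκ hη, hκ, ← compProd_prod_map_assoc,
    ← klDiv_map_of_leftInverse (f := fun p : 𝓣 × (𝓤 × 𝓥) => ((p.1, p.2.1), p.2.2))
      (g := fun p => (p.1.1, (p.1.2, p.2))) (by fun_prop) (by fun_prop) (fun _ => rfl),
    Measure.map_map (by fun_prop) (by fun_prop)]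
  rfl

lemma condMutualInfo_comm (hU : Measurable U) (hV : Measurable V) (hT : Measurable T) :
    condMutualInfo P U V T = condMutualInfo P V U T := by
  have : IsProbabilityMeasure (P.map T) := Measure.isProbabilityMeasure_map hT.aemeasurable
  rw [condMutualInfo, condMutualInfo, ← compProd_prod_map_swap _ (condDistrib U T P),
    ← klDiv_map_of_leftInverse (f := fun p : 𝓣 × (𝓤 × 𝓥) => (p.1, (p.2.2, p.2.1)))
      (g := fun p => (p.1, (p.2.2, p.2.1))) (by fun_prop) (by fun_prop) (fun _ => rfl),
    Measure.map_map (by fun_prop) (by fun_prop)]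
  rfl

lemma condMutualInfo_congr_law {U' : Ω → 𝓤} {V' : Ω → 𝓥} {T' : Ω → 𝓣}
    (hU : Measurable U) (hV : Measurable V) (hT : Measurable T)
    (hU' : Measurable U') (hV' : Measurable V') (hT' : Measurable T')
    (h : P.map (fun ω => (T ω, (U ω, V ω))) = P.map fun ω => (T' ω, (U' ω, V' ω))) :
    condMutualInfo P U V T = condMutualInfo P U' V' T' := by
  have h1 : P.map T = P.map T' := by
    have := congrArg (Measure.map Prod.fst) h
    rwa [Measure.map_map (by fun_prop) (by fun_prop),
      Measure.map_map (by fun_prop) (by fun_prop)] at this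
  have h2 : P.map (fun ω => (T ω, U ω)) = P.map (fun ω => (T' ω, U' ω)) := by
    have := congrArg (Measure.map fun p => (p.1, p.2.1)) h
    rwa [Measure.map_map (by fun_prop) (by fun_prop),
      Measure.map_map (by fun_prop) (by fun_prop)] at this
  have h3 : P.map (fun ω => (T ω, V ω)) = P.map (fun ω => (T' ω, V' ω)) := by
    have := congrArg (Measure.map fun p => (p.1, p.2.2)) h
    rwa [Measure.map_map (by fun_prop) (by fun_prop),
      Measure.map_map (by fun_prop) (by fun_prop)] at this
  rw [condMutualInfo_eq_of_kernel (κ := condDistrib U' T' P) (η := condDistrib V' T' P) hU hV,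
    h, h1, condMutualInfo]
  · rw [h2, h1, ← map_prodMk_eq_compProd_condDistrib hU']
  · rw [h3, h1, ← map_prodMk_eq_compProd_condDistrib hV']

lemma condMutualInfo_comp_equiv_right {𝓥' : Type*} [MeasurableSpace 𝓥'] [StandardBorelSpace 𝓥']
    [Nonempty 𝓥'] (hU : Measurable U) (hV : Measurable V) (hT : Measurable T) (e : 𝓥 ≃ᵐ 𝓥') :
    condMutualInfo P U (fun ω => e (V ω)) T = condMutualInfo P U V T := by
  have : IsProbabilityMeasure (P.map T) := Measure.isProbabilityMeasure_map hT.aemeasurable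
  have he := e.measurable
  have hκ := map_prodMk_eq_compProd_condDistrib (P := P) (T := T) hU
  have hη := map_prodMk_eq_compProd_condDistrib (P := P) (T := T) hV
  have : IsMarkovKernel ((condDistrib V T P).map e) := Kernel.IsMarkovKernel.map _ he
  have hη' : P.map (fun ω => (T ω, e (V ω))) = P.map T ⊗ₘ (condDistrib V T P).map e := by
    rw [Measure.compProd_map he, ← hη, Measure.map_map (by fun_prop) (by fun_prop)]
    rfl
  rw [condMutualInfo_eq_of_kernel (V := fun ω => e (V ω)) hU (he.comp hV) hκ hη',
    condMutualInfo_eq_of_kernel hU hV hκ hη,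
    ← klDiv_map_of_leftInverse (f := fun p : 𝓣 × (𝓤 × 𝓥) => (p.1, (p.2.1, e p.2.2)))
      (g := fun p => (p.1, (p.2.1, e.symm p.2.2))) (by fun_prop)
      (by have := e.symm.measurable; fun_prop) (fun _ => by simp),
    Measure.map_map (by fun_prop) (by fun_prop)]
  congr 1
  refine Measure.ext_of_lintegral _ fun f hf => ?_
  rw [lintegral_map hf (by fun_prop), Measure.lintegral_compProd hf,
    Measure.lintegral_compProd (by fun_prop)]
  refine lintegral_congr fun t => ?_
  rw [Kernel.lintegral_prod _ _ _ (by fun_prop), Kernel.lintegral_prod _ _ _ (by fun_prop)]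
  refine lintegral_congr fun u => ?_
  rw [Kernel.lintegral_map _ he _ (by fun_prop)]

lemma map_comp_compProd_comap {β : Type*} [MeasurableSpace β] {f : 𝓣 → 𝓡} {g : 𝓡 → 𝓣}
    (hT : Measurable T) (hf : Measurable f) (hg : Measurable g) (hgf : ∀ ω, g (f (T ω)) = T ω)
    (κ : Kernel 𝓣 β) [IsMarkovKernel κ] :
    P.map (fun ω => f (T ω)) ⊗ₘ κ.comap g hg = (P.map T ⊗ₘ κ).map fun p => (f p.1, p.2) := by
  refine Measure.ext_of_lintegral _ fun F hF => ?_
  rw [lintegral_map hF (by fun_prop), Measure.lintegral_compProd hF,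
    Measure.lintegral_compProd (by fun_prop), lintegral_map (by fun_prop) (by fun_prop),
    lintegral_map (by fun_prop) (by fun_prop)]
  refine lintegral_congr fun ω => ?_
  rw [Kernel.comap_apply, hgf]

/-- Data processing along `f`, with the conditional laws given `f(T)` obtained by pulling back along
`g`. Inversion is demanded only on the values of `T`, so that `f` and `g` can exchange roles without
being globally inverse. -/
lemma condMutualInfo_comp_le {f : 𝓣 → 𝓡} {g : 𝓡 → 𝓣} (hU : Measurable U) (hV : Measurable V)
    (hT : Measurable T) (hf : Measurable f) (hg : Measurable g)
    (hgf : ∀ ω, g (f (T ω)) = T ω) :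
    condMutualInfo P U V (fun ω => f (T ω)) ≤ condMutualInfo P U V T := by
  have : IsProbabilityMeasure (P.map T) := Measure.isProbabilityMeasure_map hT.aemeasurable
  have hκ := map_prodMk_eq_compProd_condDistrib (P := P) (T := T) hU
  have hη := map_prodMk_eq_compProd_condDistrib (P := P) (T := T) hV
  rw [condMutualInfo_eq_of_kernel (κ := (condDistrib U T P).comap g hg)
      (η := (condDistrib V T P).comap g hg) hU hV, condMutualInfo]
  · have h := klDiv_map_le (P.map fun ω => (T ω, (U ω, V ω)))
      (P.map T ⊗ₘ (condDistrib U T P ×ₖ condDistrib V T P))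
      (g := fun p => (f p.1, p.2)) (by fun_prop)
    rw [Measure.map_map (by fun_prop) (by fun_prop), ← map_comp_compProd_comap hT hf hg hgf] at h
    have hprod : (condDistrib U T P ×ₖ condDistrib V T P).comap g hg =
        (condDistrib U T P).comap g hg ×ₖ (condDistrib V T P).comap g hg := by
      ext1 r
      simp only [Kernel.prod_apply, Kernel.comap_apply]
    rwa [hprod] at h
  · rw [map_comp_compProd_comap hT hf hg hgf, ← hκ, Measure.map_map (by fun_prop) (by fun_prop)]; rfl
  · rw [map_comp_compProd_comap hT hf hg hgf, ← hη, Measure.map_map (by fun_prop) (by fun_prop)]; rfl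

/-- Conditioning on variables that are functions of each other gives the same conditional
mutual information. -/
lemma condMutualInfo_congr_cond {T' : Ω → 𝓡} {f : 𝓣 → 𝓡} {g : 𝓡 → 𝓣} (hU : Measurable U)
    (hV : Measurable V) (hT : Measurable T) (hf : Measurable f) (hg : Measurable g)
    (hfT : ∀ ω, f (T ω) = T' ω) (hgT : ∀ ω, g (T' ω) = T ω) :
    condMutualInfo P U V T' = condMutualInfo P U V T := by
  obtain rfl : (fun ω => f (T ω)) = T' := funext hfT
  refine le_antisymm (condMutualInfo_comp_le hU hV hT hf hg hgT) ?_
  have h := condMutualInfo_comp_le (P := P) (T := fun ω => f (T ω)) hU hV (by fun_prop) hg hf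
    (fun ω => congrArg f (hgT ω))
  simpa only [hgT] using h

/-- Chain rule for the conditional mutual information. -/
lemma condMutualInfo_prod_right {𝓐 𝓑 : Type*} [MeasurableSpace 𝓐] [StandardBorelSpace 𝓐]
    [Nonempty 𝓐] [MeasurableSpace 𝓑] [StandardBorelSpace 𝓑] [Nonempty 𝓑]
    {A : Ω → 𝓐} {B : Ω → 𝓑} (hU : Measurable U) (hA : Measurable A) (hB : Measurable B)
    (hT : Measurable T) :
    condMutualInfo P U (fun ω => (A ω, B ω)) T =
      condMutualInfo P U A T + condMutualInfo P U B (fun ω => (T ω, A ω)) := by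
  have : IsProbabilityMeasure (P.map T) := Measure.isProbabilityMeasure_map hT.aemeasurable
  have : IsProbabilityMeasure (P.map fun ω => (T ω, U ω)) :=
    Measure.isProbabilityMeasure_map (by fun_prop)
  have hA1 := map_prodMk_eq_compProd_condDistrib (P := P) (T := T) hA
  have hB1 := map_prodMk_eq_compProd_condDistrib (P := P) (T := fun ω => (T ω, A ω)) hB
  have hB2 := map_prodMk_eq_compProd_condDistrib (P := P) (T := fun ω => ((T ω, U ω), A ω)) hB
  have : IsProbabilityMeasure (P.map fun ω => ((T ω, U ω), A ω)) :=
    Measure.isProbabilityMeasure_map (by fun_prop)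
  have hAB : P.map (fun ω => (T ω, (A ω, B ω))) =
      P.map T ⊗ₘ (condDistrib A T P ⊗ₖ condDistrib B (fun ω => (T ω, A ω)) P) := by
    rw [← Measure.compProd_assoc', ← hA1, ← hB1, Measure.map_map (by fun_prop) (by fun_prop)]
    rfl
  rw [condMutualInfo_eq_klDiv_compProd hU (hA.prodMk hB) hT hAB,
    condMutualInfo_eq_klDiv_compProd hU hA hT hA1,
    condMutualInfo_eq_klDiv_compProd hU hB (hT.prodMk hA) hB1,
    ← klDiv_map_of_leftInverse (f := fun p : (𝓣 × 𝓤) × (𝓐 × 𝓑) => ((p.1, p.2.1), p.2.2))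
      (g := fun p => (p.1.1, (p.1.2, p.2))) (by fun_prop) (by fun_prop) (fun _ => rfl),
    compProd_compProd_prodMkRight_map, Measure.map_map (by fun_prop) (by fun_prop)]
  change klDiv (P.map fun ω => (((T ω, U ω), A ω), B ω)) _ = _
  -- The chain rule for the divergence splits off the law of (T,U,A), which contributes I(U;A|T).
  -- The remaining term compares P_{B|T,U,A} with P_{B|T,A}, and is I(U;B|T,A) once U and A are
  -- reordered.
  rw [hB2, klDiv_compProd_eq_add, ← hB2]
  congr 1
  rw [← klDiv_map_of_leftInverse (f := fun p : ((𝓣 × 𝓤) × 𝓐) × 𝓑 => (((p.1.1.1, p.1.2), p.1.1.2), p.2))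
      (g := fun p => (((p.1.1.1, p.1.2), p.1.1.2), p.2)) (by fun_prop) (by fun_prop)
      (fun _ => rfl), Measure.map_map (by fun_prop) (by fun_prop)]
  congr 1
  refine Measure.ext_of_lintegral _ fun f hf => ?_
  rw [lintegral_map hf (by fun_prop), Measure.lintegral_compProd (by fun_prop),
    Measure.lintegral_compProd hf, lintegral_map (by fun_prop) (by fun_prop),
    lintegral_map (by fun_prop) (by fun_prop)]
  simp

lemma map_unit_prodMk {β : Type*} [MeasurableSpace β] {B : Ω → β} (hB : Measurable B) :
    P.map (fun ω => ((), B ω)) = P.map (fun _ => ()) ⊗ₘ Kernel.const Unit (P.map B) := by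
  have : IsProbabilityMeasure (P.map B) := Measure.isProbabilityMeasure_map hB.aemeasurable
  refine Measure.ext_of_lintegral _ fun f hf => ?_
  rw [lintegral_map hf (by fun_prop), Measure.lintegral_compProd hf,
    lintegral_map (by fun_prop) (by fun_prop)]
  simp [lintegral_map (f := fun b => f ((), b)) (by fun_prop) hB]

/-- Conditioning on a constant brings unconditional information under the conditional chain rule. -/
lemma mutualInfo_eq_condMutualInfo_const (hU : Measurable U) (hV : Measurable V) :
    mutualInfo P U V = condMutualInfo P U V (fun _ => ()) := by
  have : IsProbabilityMeasure (P.map U) := Measure.isProbabilityMeasure_map hU.aemeasurable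
  have : IsProbabilityMeasure (P.map V) := Measure.isProbabilityMeasure_map hV.aemeasurable
  rw [condMutualInfo_eq_of_kernel hU hV (map_unit_prodMk hU) (map_unit_prodMk hV), mutualInfo,
    ← klDiv_map_of_leftInverse (f := fun p : 𝓤 × 𝓥 => ((), p))
      (g := fun p => p.2) (by fun_prop) (by fun_prop) (fun _ => rfl),
    Measure.map_map (by fun_prop) (by fun_prop)]
  congr 1
  refine Measure.ext_of_lintegral _ fun f hf => ?_
  rw [lintegral_map hf (by fun_prop), Measure.lintegral_compProd hf,
    lintegral_map (by fun_prop) (by fun_prop)]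
  simp [Kernel.prod_apply]

/-- Refining the conditioning variable from `S` to `T` cannot increase `I(U;V|·)` when
`V` and `T` are conditionally independent given `(S, U)`. -/
lemma condMutualInfo_le_of_condIndep [StandardBorelSpace 𝓣] [Nonempty 𝓣] {S : Ω → 𝓡}
    {f : 𝓣 → 𝓡} (hU : Measurable U) (hV : Measurable V) (hT : Measurable T) (hf : Measurable f)
    (hS : ∀ ω, f (T ω) = S ω)
    (hind : condMutualInfo P V T (fun ω => (S ω, U ω)) = 0) :
    condMutualInfo P U V T ≤ condMutualInfo P U V S := by
  obtain rfl : (fun ω => f (T ω)) = S := funext hS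
  have hS' : Measurable fun ω => f (T ω) := hf.comp hT
  -- I(V;U,T|S) is expanded in both orders: as I(V;U|S) plus a vanishing term, and as I(V;T|S) +
  -- I(V;U|S,T). Since S is a function of T, the last term is I(V;U|T).
  have h1 := condMutualInfo_prod_right (P := P) hV hU hT hS'
  have h2 := condMutualInfo_prod_right (P := P) hV hT hU hS'
  have h3 := condMutualInfo_comp_equiv_right (P := P) hV (hU.prodMk hT) hS'
    (MeasurableEquiv.prodComm (α := 𝓤) (β := 𝓣))
  have h4 : condMutualInfo P V U (fun ω => (f (T ω), T ω)) = condMutualInfo P V U T :=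
    condMutualInfo_congr_cond (f := fun t => (f t, t)) (g := Prod.snd) hV hU hT
      (by fun_prop) (by fun_prop) (fun _ => rfl) (fun _ => rfl)
  rw [condMutualInfo_comm hU hV hT, condMutualInfo_comm hU hV hS']
  rw [hind, add_zero] at h1
  rw [← h1, ← h3, ← h4]
  exact h2 ▸ le_add_self

end CondMutualInfo

-- Exchanging a sample with the fresh sample

section Exchangeability

variable {𝓦 𝓩 : Type*} [MeasurableSpace 𝓦] [MeasurableSpace 𝓩] {n : ℕ}

lemma measurable_swap_coordinate (i : Fin n) :
    Measurable fun p : (Fin n → 𝓩) × 𝓩 => (Function.update p.1 i p.2, p.1 i) :=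
  measurable_update'.prodMk ((measurable_pi_apply i).comp measurable_fst)

lemma map_swap_coordinate_pi_prod (ν : Measure 𝓩) [IsProbabilityMeasure ν] (i : Fin n) :
    ((Measure.pi fun _ : Fin n => ν).prod ν).map
        (fun p => (Function.update p.1 i p.2, p.1 i)) =
      (Measure.pi fun _ : Fin n => ν).prod ν := by
  symm
  refine Measure.prod_eq_generateFrom generateFrom_pi
    MeasurableSpace.generateFrom_measurableSet isPiSystem_pi
    MeasurableSpace.isPiSystem_measurableSet
    ⟨fun _ => Set.univ, fun _ => ⟨fun _ => Set.univ, by simp, by simp⟩, by simp,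
      Set.iUnion_const _⟩
    ⟨fun _ => Set.univ, fun _ => MeasurableSet.univ, by simp, Set.iUnion_const _⟩ ?_
  rintro _ ⟨s, hs, rfl⟩ t ht
  have hs' : ∀ j, MeasurableSet (s j) := fun j => hs j (Set.mem_univ j)
  have ht' : MeasurableSet t := ht
  -- The preimage of a box is the box with the sides `s i` and `t` exchanged, and it has the same
  -- product of masses.
  have hpre : (fun p : (Fin n → 𝓩) × 𝓩 => (Function.update p.1 i p.2, p.1 i)) ⁻¹'
      (Set.univ.pi s ×ˢ t) = Set.univ.pi (Function.update s i t) ×ˢ s i := by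
    ext p
    simp only [Set.mem_preimage, Set.mem_prod, Set.mem_univ_pi]
    constructor
    · rintro ⟨h1, h2⟩
      refine ⟨fun j => ?_, by simpa using h1 i⟩
      rcases eq_or_ne j i with rfl | hj
      · simpa using h2
      · simpa [hj] using h1 j
    · rintro ⟨h1, h2⟩
      refine ⟨fun j => ?_, by simpa using h1 i⟩
      rcases eq_or_ne j i with rfl | hj
      · simpa using h2
      · simpa [hj] using h1 j
  rw [Measure.map_apply (measurable_swap_coordinate i)
    ((MeasurableSet.univ_pi hs').prod ht'), hpre, Measure.prod_prod, Measure.pi_pi,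
    Measure.pi_pi, ← Finset.mul_prod_erase _ _ (Finset.mem_univ i),
    ← Finset.mul_prod_erase Finset.univ (fun j => ν (s j)) (Finset.mem_univ i),
    Finset.prod_congr rfl (g := fun j => ν (s j)) fun j hj => by
      rw [Function.update_of_ne (Finset.ne_of_mem_erase hj)]]
  simp only [Function.update_self]
  ring

lemma jointLaw_map_swap_coordinate (prior : Measure 𝓦) [IsProbabilityMeasure prior]
    (κ : Kernel 𝓦 𝓩) [IsMarkovKernel κ] (i : Fin n) :
    (jointLaw prior κ n).map (fun p => (p.1, (Function.update p.2.1 i p.2.2, p.2.1 i))) =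
      jointLaw prior κ n := by
  have hm := measurable_swap_coordinate (𝓩 := 𝓩) i
  have hm' : Measurable fun p : 𝓦 × ((Fin n → 𝓩) × 𝓩) =>
      (p.1, (Function.update p.2.1 i p.2.2, p.2.1 i)) :=
    measurable_fst.prodMk (hm.comp measurable_snd)
  rw [jointLaw]
  refine Measure.ext_of_lintegral _ fun f hf => ?_
  rw [lintegral_map hf hm', Measure.lintegral_compProd (f := fun p => f (p.1, _))
    (hf.comp hm'), Measure.lintegral_compProd hf]
  refine lintegral_congr fun w => ?_
  rw [Kernel.prod_apply]
  have h := map_swap_coordinate_pi_prod (κ w) i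
  change ∫⁻ b, f (w, _) ∂((Measure.pi fun _ : Fin n => κ w).prod (κ w)) =
    ∫⁻ b, f (w, b) ∂((Measure.pi fun _ : Fin n => κ w).prod (κ w))
  conv_rhs => rw [← h]
  rw [lintegral_map (by fun_prop) hm]

end Exchangeability

-- Conditional independence

section CondIndep

variable {Ω 𝓤 𝓥 𝓣 𝓡 : Type*} [MeasurableSpace Ω]
  [MeasurableSpace 𝓤] [StandardBorelSpace 𝓤] [Nonempty 𝓤]
  [MeasurableSpace 𝓥] [StandardBorelSpace 𝓥] [Nonempty 𝓥]
  [MeasurableSpace 𝓣] [StandardBorelSpace 𝓣] [Nonempty 𝓣] [MeasurableSpace 𝓡]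
  {P : Measure Ω} [IsProbabilityMeasure P] {U : Ω → 𝓤} {V : Ω → 𝓥} {T : Ω → 𝓣}

omit [StandardBorelSpace 𝓤] [Nonempty 𝓤] in
-- If the law of V given (T,U) depends only on S, itself a function of (T,U), then the same kernel
-- `η` is the law of V given S and given (S,T).
lemma condMutualInfo_eq_zero_of_map_eq_compProd {S : Ω → 𝓡} (hU : Measurable U)
    (hV : Measurable V) (hT : Measurable T) (hS : Measurable S)
    {g : 𝓣 × 𝓤 → 𝓡} (hg : Measurable g) (hgS : ∀ ω, g (T ω, U ω) = S ω)
    {η : Kernel 𝓡 𝓥} [IsMarkovKernel η]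
    (h : P.map (fun ω => ((T ω, U ω), V ω)) = P.map (fun ω => (T ω, U ω)) ⊗ₘ η.comap g hg) :
    condMutualInfo P V T S = 0 := by
  have hf : ∀ f : (𝓣 × 𝓤) × 𝓥 → ℝ≥0∞, Measurable f →
      ∫⁻ ω, f ((T ω, U ω), V ω) ∂P = ∫⁻ ω, ∫⁻ v, f ((T ω, U ω), v) ∂η (S ω) ∂P := by
    intro f hf
    have := congrArg (fun m => ∫⁻ x, f x ∂m) h
    rw [lintegral_map hf (by fun_prop), Measure.lintegral_compProd hf,
      lintegral_map (by fun_prop) (by fun_prop)] at this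
    simpa [hgS] using this
  have h1 : P.map (fun ω => (S ω, V ω)) = P.map S ⊗ₘ η := by
    refine Measure.ext_of_lintegral _ fun f hfm => ?_
    rw [lintegral_map hfm (by fun_prop), Measure.lintegral_compProd hfm,
      lintegral_map (by fun_prop) hS]
    simpa [hgS] using hf (fun p => f (g p.1, p.2)) (by fun_prop)
  have h2 : P.map (fun ω => ((S ω, T ω), V ω)) =
      P.map (fun ω => (S ω, T ω)) ⊗ₘ η.prodMkRight 𝓣 := by
    refine Measure.ext_of_lintegral _ fun f hfm => ?_
    rw [lintegral_map hfm (by fun_prop), Measure.lintegral_compProd hfm,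
      lintegral_map (by fun_prop) (by fun_prop)]
    simpa [hgS] using hf (fun p => f ((g p.1, p.1.1), p.2)) (by fun_prop)
  have : IsProbabilityMeasure (P.map fun ω => (S ω, T ω)) :=
    Measure.isProbabilityMeasure_map (by fun_prop)
  rw [condMutualInfo_comm hV hT hS, condMutualInfo_eq_klDiv_compProd hT hV hS h1, h2,
    klDiv_self]

end CondIndep

-- Law of the response in the model

section Model

variable {Ω 𝓦 𝓧 𝓨 : Type*} [MeasurableSpace Ω]
  [MeasurableSpace 𝓦] [MeasurableSpace 𝓧] [StandardBorelSpace 𝓧]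
  [MeasurableSpace 𝓨] [StandardBorelSpace 𝓨] [Nonempty 𝓨]
  {prior : Measure 𝓦} [IsProbabilityMeasure prior]
  {κ : Kernel 𝓦 (𝓧 × 𝓨)} [IsMarkovKernel κ] {n : ℕ}
  {P : Measure Ω} [IsProbabilityMeasure P]
  {W : Ω → 𝓦} {D : Ω → Fin n → 𝓧 × 𝓨} {X : Ω → 𝓧} {Y : Ω → 𝓨}

/-- Given `(X, Zⁿ, W)`, the response `Y` has conditional law `P_{Y|X,W}`. -/
lemma map_eq_compProd_condKernel (hW : Measurable W) (hD : Measurable D)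
    (hX : Measurable X) (hY : Measurable Y)
    (hlaw : P.map (fun ω => (W ω, (D ω, (X ω, Y ω)))) = jointLaw prior κ n) :
    P.map (fun ω => (((X ω, D ω), W ω), Y ω)) =
      P.map (fun ω => ((X ω, D ω), W ω)) ⊗ₘ
        κ.condKernel.comap (fun q : (𝓧 × (Fin n → 𝓧 × 𝓨)) × 𝓦 => (q.2, q.1.1))
          (by fun_prop) := by
  have key : ∀ F : 𝓦 × ((Fin n → 𝓧 × 𝓨) × (𝓧 × 𝓨)) → ℝ≥0∞, Measurable F →
      ∫⁻ ω, F (W ω, (D ω, (X ω, Y ω))) ∂P =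
        ∫⁻ w, ∫⁻ z, ∫⁻ x, ∫⁻ y, F (w, (z, (x, y))) ∂κ.condKernel (w, x) ∂κ.fst w
          ∂iidKernel κ n w ∂prior := by
    intro F hF
    rw [← lintegral_map (μ := P) (f := F) (g := fun ω => (W ω, (D ω, (X ω, Y ω)))) hF
      (by fun_prop), hlaw, jointLaw, Measure.lintegral_compProd hF]
    refine lintegral_congr fun w => ?_
    rw [Kernel.lintegral_prod _ _ _ (by fun_prop)]
    refine lintegral_congr fun z => ?_
    conv_lhs => rw [← Kernel.disintegrate κ κ.condKernel]
    rw [Kernel.lintegral_compProd _ _ _ (by fun_prop)]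
  refine Measure.ext_of_lintegral _ fun f hf => ?_
  rw [lintegral_map hf (by fun_prop), Measure.lintegral_compProd hf,
    lintegral_map (by fun_prop) (by fun_prop)]
  simp only [Kernel.comap_apply]
  rw [key (fun p => f (((p.2.2.1, p.2.1), p.1), p.2.2.2)) (by fun_prop),
    key (fun p => ∫⁻ y, f (((p.2.2.1, p.2.1), p.1), y) ∂κ.condKernel (p.1, p.2.2.1))]
  · simp
  · have : Measurable fun q : (𝓧 × (Fin n → 𝓧 × 𝓨)) × 𝓦 =>
        ∫⁻ y, f (q, y) ∂(κ.condKernel.comap (fun q : (𝓧 × (Fin n → 𝓧 × 𝓨)) × 𝓦 => (q.2, q.1.1))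
          (by fun_prop)) q := by fun_prop
    exact this.comp (f := fun p : 𝓦 × ((Fin n → 𝓧 × 𝓨) × (𝓧 × 𝓨)) => ((p.2.2.1, p.2.1), p.1))
      (by fun_prop)

end Model

-- Rate bounds by the chain rule

section Monotonicity

variable {Ω 𝓦 𝓧 𝓨 : Type*} [MeasurableSpace Ω]
  [MeasurableSpace 𝓦] [StandardBorelSpace 𝓦] [Nonempty 𝓦]
  [MeasurableSpace 𝓧] [StandardBorelSpace 𝓧]
  [MeasurableSpace 𝓨] [StandardBorelSpace 𝓨] [Nonempty 𝓨]
  {prior : Measure 𝓦} [IsProbabilityMeasure prior]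
  {κ : Kernel 𝓦 (𝓧 × 𝓨)} [IsMarkovKernel κ] {n : ℕ}
  {P : Measure Ω} [IsProbabilityMeasure P]
  {W : Ω → 𝓦} {Xs : Fin n → Ω → 𝓧} {Ys : Fin n → Ω → 𝓨} {X : Ω → 𝓧} {Y : Ω → 𝓨}

omit [StandardBorelSpace 𝓧] in
/-- The sample `Zᵢ` and the fresh sample `Z` may be exchanged. -/
lemma condMutualInfo_sample_eq_fresh (hW : Measurable W) (hXs : ∀ i, Measurable (Xs i))
    (hYs : ∀ i, Measurable (Ys i)) (hX : Measurable X) (hY : Measurable Y)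
    (hlaw : P.map (fun ω => (W ω, ((fun i => (Xs i ω, Ys i ω)), (X ω, Y ω)))) =
      jointLaw prior κ n) (i : Fin n) :
    condMutualInfo P W (Ys i)
        (fun ω => (fun j => Xs j ω, fun j : Fin i => Ys (Fin.castLE i.2.le j) ω)) =
      condMutualInfo P W Y (fun ω => (Function.update (fun j => Xs j ω) i (X ω),
        fun j : Fin i => Ys (Fin.castLE i.2.le j) ω)) := by
  have hXs' : Measurable fun ω j => Xs j ω := measurable_pi_lambda _ hXs
  have hYs' : Measurable fun ω (j : Fin i) => Ys (Fin.castLE i.2.le j) ω :=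
    measurable_pi_lambda _ fun j => hYs _
  have hup : Measurable fun ω => Function.update (fun j => Xs j ω) i (X ω) :=
    measurable_update'.comp (hXs'.prodMk hX)
  have hD : Measurable fun ω j => (Xs j ω, Ys j ω) :=
    measurable_pi_lambda _ fun j => (hXs j).prodMk (hYs j)
  have hB : Measurable fun ω => (W ω, ((fun i => (Xs i ω, Ys i ω)), (X ω, Y ω))) :=
    hW.prodMk (hD.prodMk (hX.prodMk hY))
  have hswap : Measurable fun p : 𝓦 × ((Fin n → 𝓧 × 𝓨) × (𝓧 × 𝓨)) =>
      (p.1, (Function.update p.2.1 i p.2.2, p.2.1 i)) :=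
    measurable_fst.prodMk ((measurable_swap_coordinate i).comp measurable_snd)
  have hG : Measurable fun p : 𝓦 × ((Fin n → 𝓧 × 𝓨) × (𝓧 × 𝓨)) =>
      ((fun j => (p.2.1 j).1, fun j : Fin i => (p.2.1 (Fin.castLE i.2.le j)).2),
        (p.1, (p.2.1 i).2)) := by fun_prop
  refine condMutualInfo_congr_law hW (hYs i) (hXs'.prodMk hYs') hW hY (hup.prodMk hYs') ?_
  have h := congrArg (Measure.map fun p : 𝓦 × ((Fin n → 𝓧 × 𝓨) × (𝓧 × 𝓨)) =>
      ((fun j => (p.2.1 j).1, fun j : Fin i => (p.2.1 (Fin.castLE i.2.le j)).2),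
        (p.1, (p.2.1 i).2))) (jointLaw_map_swap_coordinate (n := n) prior κ i)
  rw [← hlaw, Measure.map_map hswap hB, Measure.map_map hG (hswap.comp hB),
    Measure.map_map hG hB] at h
  refine h.symm.trans (congrArg (fun F => P.map F) (funext fun ω => ?_))
  have h1 : (fun j => (Function.update (fun j => (Xs j ω, Ys j ω)) i (X ω, Y ω) j).1) =
      Function.update (fun j => Xs j ω) i (X ω) := by
    funext j
    rcases eq_or_ne j i with rfl | hj <;> simp [*]
  have h2 : (fun j : Fin i => (Function.update (fun j => (Xs j ω, Ys j ω)) i (X ω, Y ω)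
      (Fin.castLE i.2.le j)).2) = fun j : Fin i => Ys (Fin.castLE i.2.le j) ω := by
    funext j
    -- Only outputs with index strictly below `i` are conditioned on, so the exchange leaves them
    -- unchanged.
    have hj : Fin.castLE i.2.le j ≠ i := fun h => j.2.ne (congrArg Fin.val h)
    simp [hj]
  simp only [Function.comp_apply, h1, h2, Function.update_self]

/-- The smaller conditioning variable is a function of (X,Zⁿ) that still contains X, and with W this
already determines the law of Y. -/
lemma condMutualInfo_fresh_le (hW : Measurable W) (hXs : ∀ i, Measurable (Xs i))
    (hYs : ∀ i, Measurable (Ys i)) (hX : Measurable X) (hY : Measurable Y)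
    (hlaw : P.map (fun ω => (W ω, ((fun i => (Xs i ω, Ys i ω)), (X ω, Y ω)))) =
      jointLaw prior κ n) (i : Fin n) :
    condMutualInfo P W Y (fun ω => (X ω, fun i => (Xs i ω, Ys i ω))) ≤
      condMutualInfo P W Y (fun ω => (Function.update (fun j => Xs j ω) i (X ω),
        fun j : Fin i => Ys (Fin.castLE i.2.le j) ω)) := by
  have : Nonempty 𝓧 := P.nonempty_of_neZero.map X
  have hD : Measurable fun ω j => (Xs j ω, Ys j ω) :=
    measurable_pi_lambda _ fun j => (hXs j).prodMk (hYs j)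
  have hf : Measurable fun t : 𝓧 × (Fin n → 𝓧 × 𝓨) =>
      (Function.update (fun j => (t.2 j).1) i t.1,
        fun j : Fin i => (t.2 (Fin.castLE i.2.le j)).2) := by
    refine Measurable.prodMk ?_ (by fun_prop)
    have : Measurable fun t : 𝓧 × (Fin n → 𝓧 × 𝓨) => (fun j => (t.2 j).1, t.1) := by fun_prop
    exact measurable_update'.comp this
  refine condMutualInfo_le_of_condIndep hW hY (hX.prodMk hD) hf (fun ω => rfl) ?_
  have hg : Measurable fun q : (𝓧 × (Fin n → 𝓧 × 𝓨)) × 𝓦 =>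
      ((Function.update (fun j => (q.1.2 j).1) i q.1.1,
        fun j : Fin i => (q.1.2 (Fin.castLE i.2.le j)).2), q.2) :=
    (hf.comp measurable_fst).prodMk measurable_snd
  refine condMutualInfo_eq_zero_of_map_eq_compProd (U := W) hW hY (hX.prodMk hD)
    ((hf.comp (hX.prodMk hD)).prodMk hW) hg (fun ω => rfl)
    -- Coordinate `i` of the updated input tuple is the fresh X.
    (η := κ.condKernel.comap (fun s : ((Fin n → 𝓧) × (Fin i → 𝓨)) × 𝓦 => (s.2, s.1.1 i))
      (by fun_prop)) ?_
  rw [map_eq_compProd_condKernel hW hD hX hY hlaw]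
  congr 1
  ext1 q
  simp [Kernel.comap_apply]

/-- Partial sums of the chain rule over the outputs. All `n` inputs stay in the conditioning for
every `m`, so each new output adds one term bounded below by the fresh-sample information. -/
lemma mul_condMutualInfo_le_of_le (hW : Measurable W) (hXs : ∀ i, Measurable (Xs i))
    (hYs : ∀ i, Measurable (Ys i)) (hX : Measurable X) (hY : Measurable Y)
    (hlaw : P.map (fun ω => (W ω, ((fun i => (Xs i ω, Ys i ω)), (X ω, Y ω)))) =
      jointLaw prior κ n) (m : ℕ) (hm : m ≤ n) :
    (m : ℝ≥0∞) * condMutualInfo P W Y (fun ω => (X ω, fun i => (Xs i ω, Ys i ω))) ≤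
      condMutualInfo P W (fun ω (j : Fin m) => Ys (Fin.castLE hm j) ω) (fun ω j => Xs j ω) := by
  have hXs' : Measurable fun ω j => Xs j ω := measurable_pi_lambda _ hXs
  induction m with
  | zero => simp
  | succ m ih =>
    have hYm : Measurable fun ω (j : Fin m) => Ys (Fin.castLE (Nat.le_of_succ_le hm) j) ω :=
      measurable_pi_lambda _ fun j => hYs _
    have hYm' : Measurable fun ω (j : Fin (m + 1)) => Ys (Fin.castLE hm j) ω :=
      measurable_pi_lambda _ fun j => hYs _
    have hi := (condMutualInfo_fresh_le hW hXs hYs hX hY hlaw ⟨m, hm⟩).trans_eq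
      (condMutualInfo_sample_eq_fresh hW hXs hYs hX hY hlaw ⟨m, hm⟩).symm
    have hchain := condMutualInfo_prod_right (P := P) hW hYm (hYs ⟨m, hm⟩) hXs'
    have hequiv := condMutualInfo_comp_equiv_right (P := P) hW hYm' hXs'
      -- The last output is separated from the first `m`.
      ((MeasurableEquiv.piFinSuccAbove (fun _ : Fin (m + 1) => 𝓨) (Fin.last m)).trans
        MeasurableEquiv.prodComm)
    have hfun : (fun ω => ((MeasurableEquiv.piFinSuccAbove (fun _ : Fin (m + 1) => 𝓨)
        (Fin.last m)).trans MeasurableEquiv.prodComm)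
          (fun j : Fin (m + 1) => Ys (Fin.castLE hm j) ω)) =
        fun ω => ((fun j : Fin m => Ys (Fin.castLE (Nat.le_of_succ_le hm) j) ω),
          Ys ⟨m, hm⟩ ω) := by
      funext ω
      refine Prod.ext (funext fun j => ?_) rfl
      change Ys (Fin.castLE hm ((Fin.last m).succAbove j)) ω = _
      rw [Fin.succAbove_last]
      rfl
    rw [hfun] at hequiv
    rw [← hequiv, hchain, Nat.cast_succ, add_mul, one_mul]
    exact add_le_add (ih (Nat.le_of_succ_le hm)) hi

/-- The chain rule for Zⁿ = (Xⁿ,Yⁿ), with the nonnegative term I(W;Xⁿ) dropped. -/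
lemma condMutualInfo_outputs_le_mutualInfo [Nonempty 𝓧] (hW : Measurable W)
    (hXs : ∀ i, Measurable (Xs i)) (hYs : ∀ i, Measurable (Ys i)) :
    condMutualInfo P W (fun ω i => Ys i ω) (fun ω i => Xs i ω) ≤
      mutualInfo P W (fun ω i => (Xs i ω, Ys i ω)) := by
  have hXs' : Measurable fun ω j => Xs j ω := measurable_pi_lambda _ hXs
  have hYs' : Measurable fun ω j => Ys j ω := measurable_pi_lambda _ hYs
  have hD : Measurable fun ω j => (Xs j ω, Ys j ω) :=
    measurable_pi_lambda _ fun j => (hXs j).prodMk (hYs j)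
  let e : (Fin n → 𝓧 × 𝓨) ≃ᵐ (Fin n → 𝓧) × (Fin n → 𝓨) :=
    { toFun := fun z => (fun i => (z i).1, fun i => (z i).2)
      invFun := fun p i => (p.1 i, p.2 i)
      left_inv := fun _ => rfl
      right_inv := fun _ => rfl
      measurable_toFun := by
        change Measurable fun z : Fin n → 𝓧 × 𝓨 => (fun i => (z i).1, fun i => (z i).2)
        fun_prop
      measurable_invFun := by
        change Measurable fun (p : (Fin n → 𝓧) × (Fin n → 𝓨)) i => (p.1 i, p.2 i)
        fun_prop }
  have h1 := condMutualInfo_comp_equiv_right (P := P) (T := fun _ => ()) hW hD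
    measurable_const e
  have h2 := condMutualInfo_prod_right (P := P) (T := fun _ => ()) hW hXs' hYs'
    measurable_const
  have h3 := condMutualInfo_congr_cond (P := P) (U := W) (V := fun ω i => Ys i ω)
    (T := fun ω i => Xs i ω) (T' := fun ω => ((), fun i => Xs i ω))
    (f := fun x => ((), x)) (g := Prod.snd) hW hYs' hXs'
    (by fun_prop) (by fun_prop) (fun _ => rfl) (fun _ => rfl)
  rw [mutualInfo_eq_condMutualInfo_const hW hD, ← h1, ← h3]
  exact le_add_self.trans_eq h2.symm

/-- The rate bounds on `I(W;Y|X,Zⁿ)`. -/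
lemma condMutualInfo_le_inv_mul (hW : Measurable W) (hXs : ∀ i, Measurable (Xs i))
    (hYs : ∀ i, Measurable (Ys i)) (hX : Measurable X) (hY : Measurable Y)
    (hlaw : P.map (fun ω => (W ω, ((fun i => (Xs i ω, Ys i ω)), (X ω, Y ω)))) =
      jointLaw prior κ n) (hn : 1 ≤ n) :
    condMutualInfo P W Y (fun ω => (X ω, fun i => (Xs i ω, Ys i ω))) ≤
      (n : ℝ≥0∞)⁻¹ * condMutualInfo P W (fun ω i => Ys i ω) (fun ω i => Xs i ω) := by
  have hn0 : (n : ℝ≥0∞) ≠ 0 := by exact_mod_cast (Nat.one_le_iff_ne_zero.mp hn)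
  rw [mul_comm, ← div_eq_mul_inv,
    ENNReal.le_div_iff_mul_le (.inl hn0) (.inl (ENNReal.natCast_ne_top n)), mul_comm]
  exact mul_condMutualInfo_le_of_le hW hXs hYs hX hY hlaw n le_rfl

end Monotonicity

/-- The positive part of the logarithm. -/
noncomputable def logPos (x : ℝ≥0∞) : ℝ≥0∞ := (ENNReal.log x).toENNReal

/-- The negative part of the logarithm. -/
noncomputable def logNeg (x : ℝ≥0∞) : ℝ≥0∞ := (-ENNReal.log x).toENNReal

@[fun_prop]
lemma measurable_logPos : Measurable logPos := by unfold logPos; fun_prop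

@[fun_prop]
lemma measurable_logNeg : Measurable logNeg := by unfold logNeg; fun_prop

lemma logPos_zero : logPos 0 = 0 := by simp [logPos]

lemma logNeg_zero : logNeg 0 = ⊤ := by simp [logNeg]

lemma logPos_ofReal {x : ℝ} (hx : 0 < x) :
    logPos (ENNReal.ofReal x) = ENNReal.ofReal (Real.log x) := by
  rw [logPos, ENNReal.log_ofReal_of_pos hx, EReal.real_coe_toENNReal]

lemma logNeg_ofReal {x : ℝ} (hx : 0 < x) :
    logNeg (ENNReal.ofReal x) = ENNReal.ofReal (-Real.log x) := by
  rw [logNeg, ENNReal.log_ofReal_of_pos hx, ← EReal.coe_neg, EReal.real_coe_toENNReal]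

lemma logPos_inv (x : ℝ≥0∞) : logPos x⁻¹ = logNeg x := by
  rw [logPos, logNeg, ENNReal.log_inv]

lemma logNeg_inv (x : ℝ≥0∞) : logNeg x⁻¹ = logPos x := by
  rw [logPos, logNeg, ENNReal.log_inv, neg_neg]

-- Pointwise inequalities for the parts of the logarithm

section Pointwise

variable {p q : ℝ≥0}

lemma exists_log_ratio (hp : p ≠ 0) (hq : q ≠ 0) :
    ∃ x y : ℝ, logPos p = ENNReal.ofReal x ∧ logNeg p = ENNReal.ofReal (-x) ∧
      logPos q = ENNReal.ofReal y ∧ logNeg q = ENNReal.ofReal (-y) ∧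
      logPos ((q : ℝ≥0∞) / p) = ENNReal.ofReal (y - x) ∧
      logNeg ((q : ℝ≥0∞) / p) = ENNReal.ofReal (x - y) ∧
      (q : ℝ≥0∞) / p = ENNReal.ofReal (Real.exp (y - x)) := by
  have hp' : (0 : ℝ) < p := by exact_mod_cast pos_of_ne_zero hp
  have hq' : (0 : ℝ) < q := by exact_mod_cast pos_of_ne_zero hq
  have hr : (q : ℝ≥0∞) / p = ENNReal.ofReal (q / p : ℝ) := by
    rw [ENNReal.ofReal_div_of_pos hp', ENNReal.ofReal_coe_nnreal, ENNReal.ofReal_coe_nnreal]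
  refine ⟨Real.log p, Real.log q, ?_⟩
  rw [hr, logPos_ofReal (div_pos hq' hp'), logNeg_ofReal (div_pos hq' hp'),
    ← ENNReal.ofReal_coe_nnreal, ← ENNReal.ofReal_coe_nnreal, logPos_ofReal hp',
    logNeg_ofReal hp', logPos_ofReal hq', logNeg_ofReal hq', Real.log_div hq'.ne' hp'.ne',
    Real.exp_sub, Real.exp_log hp', Real.exp_log hq', neg_sub]
  simp

/-- This is -log q = -log p - log(q/p) with all parts moved so that nothing is subtracted; at q = 0
both sides are infinite. -/
lemma logNeg_add_logPos_ratio (hp : p ≠ 0) :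
    logNeg q + logPos p + logPos ((q : ℝ≥0∞) / p) =
      logPos q + logNeg p + logNeg ((q : ℝ≥0∞) / p) := by
  rcases eq_or_ne q 0 with rfl | hq
  · simp [logNeg_zero]
  · obtain ⟨x, y, h1, h2, h3, h4, h5, h6, -⟩ := exists_log_ratio hp hq
    rw [h1, h2, h3, h4, h5, h6]
    simp only [ENNReal.ofReal]
    norm_cast
    refine NNReal.eq ?_
    push_cast
    simp only [Real.coe_toNNReal']
    rcases le_total 0 x with hx | hx <;> rcases le_total 0 y with hy | hy <;>
      rcases le_total x y with hxy | hxy <;> simp [*] <;> linarith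

lemma logNeg_le_add_logPos_ratio (hp : p ≠ 0) :
    logNeg p ≤ logNeg q + logPos ((q : ℝ≥0∞) / p) := by
  rcases eq_or_ne q 0 with rfl | hq
  · simp [logNeg_zero]
  · obtain ⟨x, y, h1, h2, h3, h4, h5, h6, -⟩ := exists_log_ratio hp hq
    rw [h2, h4, h5]
    refine le_trans (le_of_eq ?_) ENNReal.ofReal_add_le
    congr 1; ring

lemma logPos_le_add_logPos_ratio (hp : p ≠ 0) :
    logPos q ≤ logPos p + logPos ((q : ℝ≥0∞) / p) := by
  rcases eq_or_ne q 0 with rfl | hq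
  · simp [logPos_zero]
  · obtain ⟨x, y, h1, h2, h3, h4, h5, h6, -⟩ := exists_log_ratio hp hq
    rw [h1, h3, h5]
    refine le_trans (le_of_eq ?_) ENNReal.ofReal_add_le
    congr 1; ring

lemma logNeg_le_add_logNeg_ratio (hp : p ≠ 0) :
    logNeg q ≤ logNeg p + logNeg ((q : ℝ≥0∞) / p) := by
  rcases eq_or_ne q 0 with rfl | hq
  · simp [logNeg_zero]
  · obtain ⟨x, y, h1, h2, h3, h4, h5, h6, -⟩ := exists_log_ratio hp hq
    rw [h2, h4, h6]
    refine le_trans (le_of_eq ?_) ENNReal.ofReal_add_le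
    congr 1; ring

lemma logPos_ratio_le (hp : p ≠ 0) : logPos ((q : ℝ≥0∞) / p) ≤ (q : ℝ≥0∞) / p := by
  rcases eq_or_ne q 0 with rfl | hq
  · simp [logPos_zero]
  · obtain ⟨x, y, -, -, -, -, h5, -, h7⟩ := exists_log_ratio hp hq
    rw [h5, h7]
    exact ENNReal.ofReal_le_ofReal (by linarith [Real.add_one_le_exp (y - x)])

/-- This is log r + 1 ≤ r for r = q/p, the pointwise source of Gibbs' inequality. -/
lemma logPos_ratio_add_one_le (hp : p ≠ 0) :
    logPos ((q : ℝ≥0∞) / p) + 1 ≤ logNeg ((q : ℝ≥0∞) / p) + (q : ℝ≥0∞) / p := by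
  rcases eq_or_ne q 0 with rfl | hq
  · simp [logNeg_zero]
  · obtain ⟨x, y, -, -, -, -, h5, h6, h7⟩ := exists_log_ratio hp hq
    rw [h5, h6, h7]
    have h := Real.add_one_le_exp (y - x)
    rcases le_total x y with hxy | hxy
    · rw [ENNReal.ofReal_of_nonpos (p := x - y) (by linarith), zero_add, ← ENNReal.ofReal_one,
        ← ENNReal.ofReal_add (by linarith) zero_le_one]
      exact ENNReal.ofReal_le_ofReal h
    · rw [ENNReal.ofReal_of_nonpos (p := y - x) (by linarith), zero_add, ← ENNReal.ofReal_one,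
        ← ENNReal.ofReal_add (by linarith) (Real.exp_nonneg _)]
      exact ENNReal.ofReal_le_ofReal (by linarith)

end Pointwise

-- Extended-real bookkeeping for risks

section Integrated

/-- The relations between the positive and negative parts `e, f` of `E[-log q]`, `a, b` of
`E[-log p]` and `c, d` of `E[-log (q / p)]`. -/
structure ExcessLossParts (a b c d e f : ℝ≥0∞) : Prop where
  balance : e + b + d = f + a + c
  base_pos_le : a ≤ e + d
  neg_le : f ≤ b + d
  pos_le : e ≤ a + c
  gap_neg_le_one : d ≤ 1
  gap_neg_le : d ≤ c

lemma excessLossParts {Ω : Type*} [MeasurableSpace Ω] {P : Measure Ω} [IsProbabilityMeasure P]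
    {p q : Ω → ℝ≥0} (hp : Measurable p) (hq : Measurable q) (hp0 : ∀ᵐ ω ∂P, p ω ≠ 0)
    (hr : ∫⁻ ω, (q ω : ℝ≥0∞) / p ω ∂P ≤ 1) :
    ExcessLossParts (∫⁻ ω, logNeg (p ω) ∂P) (∫⁻ ω, logPos (p ω) ∂P)
      (∫⁻ ω, logNeg (q ω / p ω) ∂P) (∫⁻ ω, logPos (q ω / p ω) ∂P)
      (∫⁻ ω, logNeg (q ω) ∂P) (∫⁻ ω, logPos (q ω) ∂P) := by
  have hd : ∫⁻ ω, logPos (q ω / p ω) ∂P ≤ 1 := by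
    refine (lintegral_mono_ae ?_).trans hr
    filter_upwards [hp0] with ω h using logPos_ratio_le h
  refine ⟨?_, ?_, ?_, ?_, hd, ?_⟩
  · rw [← lintegral_add_left (by fun_prop), ← lintegral_add_left (by fun_prop),
      ← lintegral_add_left (by fun_prop), ← lintegral_add_left (by fun_prop)]
    refine lintegral_congr_ae ?_
    filter_upwards [hp0] with ω h using logNeg_add_logPos_ratio h
  · rw [← lintegral_add_left (by fun_prop)]
    refine lintegral_mono_ae ?_
    filter_upwards [hp0] with ω h using logNeg_le_add_logPos_ratio h
  · rw [← lintegral_add_left (by fun_prop)]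
    refine lintegral_mono_ae ?_
    filter_upwards [hp0] with ω h using logPos_le_add_logPos_ratio h
  · rw [← lintegral_add_left (by fun_prop)]
    refine lintegral_mono_ae ?_
    filter_upwards [hp0] with ω h using logNeg_le_add_logNeg_ratio h
  · have h1 : ∫⁻ ω, logPos (q ω / p ω) ∂P + 1 ≤
        ∫⁻ ω, logNeg (q ω / p ω) ∂P + ∫⁻ ω, (q ω : ℝ≥0∞) / p ω ∂P := by
      have : (1 : ℝ≥0∞) = ∫⁻ _, 1 ∂P := by simp
      rw [this, ← lintegral_add_left (by fun_prop), ← lintegral_add_left (by fun_prop)]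
      refine lintegral_mono_ae ?_
      filter_upwards [hp0] with ω h using logPos_ratio_add_one_le h
    -- The bound E[q/p] ≤ 1 lets the constant 1 cancel.
    exact (ENNReal.add_le_add_iff_right ENNReal.one_ne_top).mp (h1.trans (by gcongr))

/-- The Bayes risk in terms of the positive and negative parts of the optimal loss. -/
noncomputable def riskOfParts (a b : ℝ≥0∞) : EReal :=
  if a = ⊤ then ⊤ else (a : EReal) - (b : EReal)

variable {a b c d e f : ℝ≥0∞}

/-- In the finite case e - f = (a - b) + (c - d) with d ≤ c. If e is infinite the right side is ⊤;
if e is finite and b infinite, the left side is ⊥. -/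
lemma ExcessLossParts.riskOfParts_le (h : ExcessLossParts a b c d e f) (hef : e ≠ ⊤ ∨ f ≠ ⊤) :
    riskOfParts a b ≤ (e : EReal) - (f : EReal) := by
  obtain ⟨h1, h2, h3, h4, h5, h6⟩ := h
  have hd : d ≠ ⊤ := ne_top_of_le_ne_top ENNReal.one_ne_top h5
  rw [riskOfParts]
  by_cases he : e = ⊤
  · have hf : f ≠ ⊤ := hef.resolve_left (not_not.mpr he)
    lift f to ℝ≥0 using hf
    subst he
    simp
  have ha : a ≠ ⊤ := ne_top_of_le_ne_top (ENNReal.add_ne_top.mpr ⟨he, hd⟩) h2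
  rw [if_neg ha]
  by_cases hb : b = ⊤
  · subst hb
    lift a to ℝ≥0 using ha
    simp
  have hf : f ≠ ⊤ := ne_top_of_le_ne_top (ENNReal.add_ne_top.mpr ⟨hb, hd⟩) h3
  have hc : c ≠ ⊤ := by
    rintro rfl
    simp [he, hb, hd] at h1
  lift a to ℝ≥0 using ha
  lift b to ℝ≥0 using hb
  lift c to ℝ≥0 using hc
  lift d to ℝ≥0 using hd
  lift e to ℝ≥0 using he
  lift f to ℝ≥0 using hf
  norm_cast at h1 h6
  have h1' : (e : ℝ) + b + d = f + a + c := by exact_mod_cast h1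
  have h6' : (d : ℝ) ≤ c := by exact_mod_cast h6
  simp only [EReal.coe_nnreal_eq_coe_real]
  norm_cast
  linarith

/-- As d ≤ 1, infinite a forces infinite e, which `htop` excludes. If b is infinite the subtracted
risk is ⊥, and `hbot` with the balance forces c = ⊤; if e is infinite then c is too. Otherwise
everything is finite and the balance is solved for c - d. -/
lemma ExcessLossParts.riskOfParts_sub (h : ExcessLossParts a b c d e f)
    (htop : ¬ (riskOfParts e f = ⊤ ∧ riskOfParts a b = ⊤))
    (hbot : ¬ (riskOfParts e f = ⊥ ∧ riskOfParts a b = ⊥)) :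
    riskOfParts e f - riskOfParts a b = (c : EReal) - (d : EReal) := by
  obtain ⟨h1, h2, h3, h4, h5, h6⟩ := h
  have hd : d ≠ ⊤ := ne_top_of_le_ne_top ENNReal.one_ne_top h5
  have hae : a = ⊤ → e = ⊤ := by
    rintro rfl
    exact (ENNReal.add_eq_top.mp (top_le_iff.mp h2)).resolve_right hd
  have ha : a ≠ ⊤ := fun ha => htop ⟨by simp [riskOfParts, hae ha], by simp [riskOfParts, ha]⟩
  have hec : e = ⊤ → c = ⊤ := by
    rintro rfl
    exact (ENNReal.add_eq_top.mp (top_le_iff.mp h4)).resolve_left ha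
  have hrab : riskOfParts a b = (a : EReal) - b := if_neg ha
  by_cases hb : b = ⊤
  · have hbot' : riskOfParts a b = ⊥ := by rw [hrab, hb]; simp
    have hef : riskOfParts e f ≠ ⊥ := fun h => hbot ⟨h, hbot'⟩
    have hc : c = ⊤ := by
      by_cases he : e = ⊤
      · exact hec he
      have hf : f ≠ ⊤ := by
        rintro rfl
        exact hef (by simp [riskOfParts, he])
      by_contra hc
      rw [hb, add_top, top_add] at h1
      exact ENNReal.add_ne_top.mpr ⟨ENNReal.add_ne_top.mpr ⟨hf, ha⟩, hc⟩ h1.symm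
    rw [hbot', EReal.sub_bot hef, hc]
    lift d to ℝ≥0 using hd
    simp
  have hf : f ≠ ⊤ := ne_top_of_le_ne_top (ENNReal.add_ne_top.mpr ⟨hb, hd⟩) h3
  by_cases he : e = ⊤
  · rw [hrab, hec he, he]
    lift a to ℝ≥0 using ha
    lift b to ℝ≥0 using hb
    lift d to ℝ≥0 using hd
    simp only [riskOfParts, if_true, EReal.coe_nnreal_eq_coe_real, EReal.coe_ennreal_top,
      EReal.top_sub_coe]
    exact EReal.top_sub_coe _
  have hc : c ≠ ⊤ := by
    rintro rfl
    simp [he, hb, hd] at h1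
  rw [hrab, riskOfParts, if_neg he]
  lift a to ℝ≥0 using ha
  lift b to ℝ≥0 using hb
  lift c to ℝ≥0 using hc
  lift d to ℝ≥0 using hd
  lift e to ℝ≥0 using he
  lift f to ℝ≥0 using hf
  norm_cast at h1
  have h1' : (e : ℝ) + b + d = f + a + c := by exact_mod_cast h1
  simp only [EReal.coe_nnreal_eq_coe_real]
  norm_cast
  linarith

end Integrated

-- Kernels with densities and their divergence

section DensityKernel

variable {Ω 𝓢 𝓥 𝓨 : Type*} [MeasurableSpace Ω] [MeasurableSpace 𝓢] [MeasurableSpace 𝓥]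
  [MeasurableSpace 𝓨] {μ : Measure 𝓨} [SigmaFinite μ]

/-- The decision rule `ψ` has jointly measurable densities. -/
def MeasurableDensity (ψ : 𝓥 → ProbDensity μ) : Prop :=
  Measurable fun q : 𝓥 × 𝓨 => (ψ q.1).toFun q.2

omit [SigmaFinite μ] in
lemma MeasurableDensity.comp {ψ : 𝓥 → ProbDensity μ} (hψ : MeasurableDensity ψ) {g : 𝓢 → 𝓥}
    (hg : Measurable g) : MeasurableDensity fun s => ψ (g s) :=
  Measurable.comp (f := fun q : 𝓢 × 𝓨 => (g q.1, q.2)) hψ (by fun_prop)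

omit [SigmaFinite μ] in
lemma MeasurableDensity.uncurry {ψ : 𝓥 → ProbDensity μ} (hψ : MeasurableDensity ψ) :
    Measurable (Function.uncurry fun v y => ((ψ v).toFun y : ℝ≥0∞)) :=
  measurable_coe_nnreal_ennreal.comp hψ

/-- The kernel whose laws have the densities `ψ v` with respect to `μ`. -/
noncomputable def densityKernel (ψ : 𝓥 → ProbDensity μ) : Kernel 𝓥 𝓨 :=
  (Kernel.const 𝓥 μ).withDensity fun v y => ((ψ v).toFun y : ℝ≥0∞)

lemma densityKernel_apply {ψ : 𝓥 → ProbDensity μ} (hψ : MeasurableDensity ψ) (v : 𝓥) :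
    densityKernel ψ v = μ.withDensity fun y => ((ψ v).toFun y : ℝ≥0∞) := by
  rw [densityKernel, Kernel.withDensity_apply _ hψ.uncurry, Kernel.const_apply]

lemma isMarkovKernel_densityKernel {ψ : 𝓥 → ProbDensity μ} (hψ : MeasurableDensity ψ) :
    IsMarkovKernel (densityKernel ψ) := by
  refine ⟨fun v => ⟨?_⟩⟩
  rw [densityKernel_apply hψ, withDensity_apply _ MeasurableSet.univ, Measure.restrict_univ,
    (ψ v).lintegral_eq_one]

lemma densityKernel_comap {ψ : 𝓥 → ProbDensity μ} (hψ : MeasurableDensity ψ) {g : 𝓢 → 𝓥}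
    (hg : Measurable g) :
    (densityKernel ψ).comap g hg = densityKernel fun s => ψ (g s) := by
  ext1 s
  rw [Kernel.comap_apply, densityKernel_apply hψ, densityKernel_apply (hψ.comp hg)]

lemma lintegral_densityKernel {ψ : 𝓥 → ProbDensity μ} (hψ : MeasurableDensity ψ) (v : 𝓥)
    {F : 𝓨 → ℝ≥0∞} (hF : Measurable F) :
    ∫⁻ y, F y ∂densityKernel ψ v = ∫⁻ y, (ψ v).toFun y * F y ∂μ := by
  rw [densityKernel, Kernel.lintegral_withDensity _ hψ.uncurry _ hF, Kernel.const_apply]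

variable {ρ : Measure 𝓥} [IsProbabilityMeasure ρ] {p q : 𝓥 → ProbDensity μ}

lemma lintegral_compProd_densityKernel (hp : MeasurableDensity p) {F : 𝓥 × 𝓨 → ℝ≥0∞}
    (hF : Measurable F) :
    ∫⁻ z, F z ∂(ρ ⊗ₘ densityKernel p) = ∫⁻ v, ∫⁻ y, (p v).toFun y * F (v, y) ∂μ ∂ρ := by
  have := isMarkovKernel_densityKernel hp
  rw [Measure.lintegral_compProd hF]
  exact lintegral_congr fun v => lintegral_densityKernel hp v (by fun_prop)

lemma density_ne_zero_ae (hp : MeasurableDensity p) :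
    ∀ᵐ z ∂(ρ ⊗ₘ densityKernel p), (p z.1).toFun z.2 ≠ 0 := by
  have hm : MeasurableSet {z : 𝓥 × 𝓨 | (p z.1).toFun z.2 = 0} :=
    hp (measurableSet_singleton 0)
  rw [ae_iff]
  simp only [not_not]
  rw [← lintegral_indicator_one hm,
    lintegral_compProd_densityKernel hp (measurable_one.indicator hm)]
  refine (lintegral_congr fun v => (lintegral_congr fun y => ?_).trans
    (lintegral_zero (μ := μ))).trans lintegral_zero
  by_cases h : (p v).toFun y = 0 <;> simp [Set.indicator, h]

/-- Equality can fail, because q may charge the set where p vanishes. -/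
lemma lintegral_ratio_le_one (hp : MeasurableDensity p)
    (hq : MeasurableDensity q) :
    ∫⁻ z, ((q z.1).toFun z.2 : ℝ≥0∞) / (p z.1).toFun z.2 ∂(ρ ⊗ₘ densityKernel p) ≤ 1 := by
  have hm : Measurable fun z : 𝓥 × 𝓨 =>
      ((q z.1).toFun z.2 : ℝ≥0∞) / (p z.1).toFun z.2 := hq.uncurry.div hp.uncurry
  rw [lintegral_compProd_densityKernel hp hm]
  calc ∫⁻ v, ∫⁻ y, (p v).toFun y * ((q v).toFun y / (p v).toFun y : ℝ≥0∞) ∂μ ∂ρ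
      ≤ ∫⁻ v, ∫⁻ y, ((q v).toFun y : ℝ≥0∞) ∂μ ∂ρ :=
        lintegral_mono fun v => lintegral_mono fun y => ENNReal.mul_div_le
    _ = 1 := by simp [(q _).lintegral_eq_one]

lemma compProd_densityKernel_eq_withDensity (hp : MeasurableDensity p)
    (hq : MeasurableDensity q)
    (hpq : ∀ᵐ z ∂(ρ ⊗ₘ densityKernel p), (q z.1).toFun z.2 ≠ 0) :
    ρ ⊗ₘ densityKernel p = (ρ ⊗ₘ densityKernel q).withDensity
      fun z => ((p z.1).toFun z.2 : ℝ≥0∞) / (q z.1).toFun z.2 := by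
  have := isMarkovKernel_densityKernel hp
  have hm : Measurable fun z : 𝓥 × 𝓨 =>
      ((p z.1).toFun z.2 : ℝ≥0∞) / (q z.1).toFun z.2 := hp.uncurry.div hq.uncurry
  -- Nonvanishing of q under the law of p means that p vanishes μ-almost everywhere where q does, so
  -- p = q · (p/q) there.
  have hzero : ∀ᵐ v ∂ρ, ∀ᵐ y ∂μ, (q v).toFun y = 0 → (p v).toFun y = 0 := by
    filter_upwards [Measure.ae_ae_of_ae_compProd hpq] with v hv
    rw [densityKernel_apply hp, ae_withDensity_iff
      ((p v).measurable_toFun.coe_nnreal_ennreal)] at hv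
    filter_upwards [hv] with y hy hqy
    by_contra hpy
    exact hy (by simpa using hpy) hqy
  refine Measure.ext_of_lintegral _ fun F hF => ?_
  rw [lintegral_withDensity_eq_lintegral_mul _ hm hF,
    lintegral_compProd_densityKernel hp hF,
    lintegral_compProd_densityKernel hq (hm.mul hF)]
  refine lintegral_congr_ae ?_
  filter_upwards [hzero] with v hv
  refine lintegral_congr_ae ?_
  filter_upwards [hv] with y hy
  rw [Pi.mul_apply, ← mul_assoc]
  congr 1
  by_cases h : (q v).toFun y = 0
  · simp [h, hy h]
  · rw [ENNReal.mul_div_cancel (by simpa using h) ENNReal.coe_ne_top]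

lemma klDiv_compProd_densityKernel (hp : MeasurableDensity p)
    (hq : MeasurableDensity q)
    (hpq : ∀ᵐ z ∂(ρ ⊗ₘ densityKernel p), (q z.1).toFun z.2 ≠ 0)
    (hfin : ∫⁻ z, logPos ((q z.1).toFun z.2 / (p z.1).toFun z.2) ∂(ρ ⊗ₘ densityKernel p) ≠ ⊤) :
    (klDiv (ρ ⊗ₘ densityKernel p) (ρ ⊗ₘ densityKernel q) : EReal) =
      ((∫⁻ z, logNeg ((q z.1).toFun z.2 / (p z.1).toFun z.2) ∂(ρ ⊗ₘ densityKernel p) : ℝ≥0∞)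
        : EReal) -
      ((∫⁻ z, logPos ((q z.1).toFun z.2 / (p z.1).toFun z.2) ∂(ρ ⊗ₘ densityKernel p) : ℝ≥0∞)
        : EReal) := by
  have := isMarkovKernel_densityKernel hp
  have := isMarkovKernel_densityKernel hq
  have hm : Measurable fun z : 𝓥 × 𝓨 =>
      ((p z.1).toFun z.2 : ℝ≥0∞) / (q z.1).toFun z.2 := hp.uncurry.div hq.uncurry
  have hwd := compProd_densityKernel_eq_withDensity hp hq hpq
  set M := ρ ⊗ₘ densityKernel p with hM
  set N := ρ ⊗ₘ densityKernel q with hN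
  have hac : M ≪ N := by rw [hwd]; exact withDensity_absolutelyContinuous _ _
  have hrn : M.rnDeriv N =ᵐ[M]
      fun z => ((p z.1).toFun z.2 : ℝ≥0∞) / (q z.1).toFun z.2 := by
    have h := Measure.rnDeriv_withDensity N hm
    rw [← hwd] at h
    exact hac.ae_le h
  have hparts : ∀ᵐ z ∂M,
      ENNReal.ofReal (llr M N z) = logNeg ((q z.1).toFun z.2 / (p z.1).toFun z.2) ∧
      ENNReal.ofReal (-llr M N z) = logPos ((q z.1).toFun z.2 / (p z.1).toFun z.2) := by
    filter_upwards [hrn, hpq, density_ne_zero_ae (ρ := ρ) hp] with z hz hqz hpz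
    have hq' : (0 : ℝ) < (q z.1).toFun z.2 := by exact_mod_cast pos_of_ne_zero hqz
    have hp' : (0 : ℝ) < (p z.1).toFun z.2 := by exact_mod_cast pos_of_ne_zero hpz
    have hr : ((p z.1).toFun z.2 : ℝ≥0∞) / (q z.1).toFun z.2 =
        ENNReal.ofReal ((p z.1).toFun z.2 / (q z.1).toFun z.2 : ℝ) := by
      rw [ENNReal.ofReal_div_of_pos hq', ENNReal.ofReal_coe_nnreal, ENNReal.ofReal_coe_nnreal]
    have hinv : ((q z.1).toFun z.2 : ℝ≥0∞) / (p z.1).toFun z.2 =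
        (ENNReal.ofReal ((p z.1).toFun z.2 / (q z.1).toFun z.2 : ℝ))⁻¹ := by
      rw [← hr, ENNReal.inv_div (.inl ENNReal.coe_ne_top) (.inl (by simpa using hqz))]
    rw [hinv, logNeg_inv, logPos_inv, logPos_ofReal (div_pos hp' hq'),
      logNeg_ofReal (div_pos hp' hq'), llr, hz, hr, ENNReal.toReal_ofReal (by positivity)]
    exact ⟨rfl, rfl⟩
  have hpos := lintegral_congr_ae (hparts.mono fun z hz => hz.1)
  have hneg := lintegral_congr_ae (hparts.mono fun z hz => hz.2)
  rw [← hpos, ← hneg]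
  rw [← hneg] at hfin
  by_cases hint : Integrable (llr M N) M
  · have hnn := integral_llr_add_sub_measure_univ_nonneg hac hint
    have hpf : ∫⁻ z, ENNReal.ofReal (llr M N z) ∂M ≠ ⊤ := hint.lintegral_lt_top.ne
    rw [klDiv_of_ac_of_integrable hac hint, EReal.coe_ennreal_ofReal, max_eq_left hnn,
      integral_eq_lintegral_pos_part_sub_lintegral_neg_part hint, probReal_univ, probReal_univ,
      add_sub_cancel_right, EReal.coe_sub, EReal.coe_ennreal_toReal hpf,
      EReal.coe_ennreal_toReal hfin]
  -- The negative part is finite by `hfin`, so non-integrability comes from the positive part, in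
  -- agreement with the value ⊤ of `klDiv`.
  · have htop : ∫⁻ z, ENNReal.ofReal (llr M N z) ∂M = ⊤ := by
      by_contra hpf
      refine hint ⟨(measurable_llr M N).aestronglyMeasurable, ?_⟩
      have hle : ∫⁻ z, ‖llr M N z‖ₑ ∂M ≤
          ∫⁻ z, ENNReal.ofReal (llr M N z) ∂M + ∫⁻ z, ENNReal.ofReal (-llr M N z) ∂M := by
        rw [← lintegral_add_left (measurable_llr M N).ennreal_ofReal]
        refine lintegral_mono fun z => ?_
        rw [← ofReal_norm, Real.norm_eq_abs]
        rcases abs_cases (llr M N z) with ⟨h, -⟩ | ⟨h, -⟩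
        · rw [h]; exact le_self_add
        · rw [h]; exact le_add_self
      exact hle.trans_lt (ENNReal.add_lt_top.mpr ⟨lt_top_iff_ne_top.mpr hpf,
        lt_top_iff_ne_top.mpr hfin⟩)
    rw [klDiv_of_not_integrable hint, htop]
    lift (∫⁻ z, ENNReal.ofReal (-llr M N z) ∂M) to ℝ≥0 using hfin with r
    simp

end DensityKernel

-- Existence of densities and the Bayes risk under log loss

section Disintegration

variable {Ω 𝓥 𝓨 : Type*} [MeasurableSpace Ω] [MeasurableSpace 𝓥] [MeasurableSpace 𝓨]
  {μ : Measure 𝓨} [SigmaFinite μ] {P : Measure Ω} [IsProbabilityMeasure P]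
  {V : Ω → 𝓥} {Y : Ω → 𝓨}

/-- Dominated conditional laws have jointly measurable probability densities. -/
lemma exists_measurableDensity (hV : Measurable V) (hY : Measurable Y)
    (hac : P.map (fun ω => (V ω, Y ω)) ≪ (P.map V).prod μ) :
    ∃ p : 𝓥 → ProbDensity μ, MeasurableDensity p ∧
      P.map (fun ω => (V ω, Y ω)) = P.map V ⊗ₘ densityKernel p := by
  classical
  have : IsProbabilityMeasure (P.map V) := Measure.isProbabilityMeasure_map hV.aemeasurable
  have : IsProbabilityMeasure (P.map fun ω => (V ω, Y ω)) :=
    Measure.isProbabilityMeasure_map (by fun_prop)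
  set ρ := P.map V with hρ
  set M := P.map (fun ω => (V ω, Y ω)) with hM
  let g : 𝓥 × 𝓨 → ℝ≥0 := fun z => (M.rnDeriv (ρ.prod μ) z).toNNReal
  have hg : Measurable g := (Measure.measurable_rnDeriv _ _).ennreal_toNNReal
  have hg' : Measurable fun z => (g z : ℝ≥0∞) := hg.coe_nnreal_ennreal
  have hMg : M = (ρ.prod μ).withDensity fun z => (g z : ℝ≥0∞) := by
    refine (Measure.withDensity_rnDeriv_eq M (ρ.prod μ) hac).symm.trans
      (withDensity_congr_ae ?_)
    filter_upwards [Measure.rnDeriv_lt_top M (ρ.prod μ)] with z hz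
    exact (ENNReal.coe_toNNReal hz.ne).symm
  have hlint : ∀ F : 𝓥 × 𝓨 → ℝ≥0∞, Measurable F →
      ∫⁻ z, F z ∂M = ∫⁻ v, ∫⁻ y, g (v, y) * F (v, y) ∂μ ∂ρ := by
    intro F hF
    rw [hMg, lintegral_withDensity_eq_lintegral_mul _ hg' hF, lintegral_prod _ (by fun_prop)]
    rfl
  have hI : Measurable fun v => ∫⁻ y, (g (v, y) : ℝ≥0∞) ∂μ := hg'.lintegral_prod_right'
  -- The first marginal of `M` is `ρ`, so almost every section of `g` has mass one.
  have hone : (fun v => ∫⁻ y, (g (v, y) : ℝ≥0∞) ∂μ) =ᵐ[ρ] fun _ => 1 := by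
    refine ae_eq_of_forall_setLIntegral_eq_of_sigmaFinite hI measurable_const
      fun s hs _ => ?_
    have hs' : MeasurableSet (Prod.fst ⁻¹' s : Set (𝓥 × 𝓨)) := measurable_fst hs
    have h1 : M (Prod.fst ⁻¹' s) = ρ s := by
      rw [hM, Measure.map_apply (by fun_prop) hs', hρ, Measure.map_apply hV hs]
      rfl
    rw [setLIntegral_one, ← h1, ← lintegral_indicator_one hs',
      hlint _ (measurable_one.indicator hs'), ← lintegral_indicator hs]
    refine lintegral_congr fun v => ?_
    by_cases hv : v ∈ s <;> simp [Set.indicator, hv]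
  obtain ⟨v₀, hv₀⟩ := hone.exists
  have hA : MeasurableSet {v | ∫⁻ y, (g (v, y) : ℝ≥0∞) ∂μ = 1} :=
    hI (measurableSet_singleton 1)
  -- A `ProbDensity` is needed at every point, so the exceptional null set is sent to one good point
  -- `v₀`.
  let r : 𝓥 → 𝓥 := fun v => if ∫⁻ y, (g (v, y) : ℝ≥0∞) ∂μ = 1 then v else v₀
  have hr : Measurable r := Measurable.ite hA measurable_id measurable_const
  have hr1 : ∀ v, ∫⁻ y, (g (r v, y) : ℝ≥0∞) ∂μ = 1 := by
    intro v
    by_cases hv : ∫⁻ y, (g (v, y) : ℝ≥0∞) ∂μ = 1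
    · simp [r, hv]
    · simpa [r, hv] using hv₀
  refine ⟨fun v => ⟨fun y => g (r v, y), by fun_prop, hr1 v⟩, ?_, ?_⟩
  · change Measurable fun q : 𝓥 × 𝓨 => g (r q.1, q.2)
    fun_prop
  · have hmd : MeasurableDensity (μ := μ) (𝓥 := 𝓥)
        fun v => ⟨fun y => g (r v, y), by fun_prop, hr1 v⟩ := by
      change Measurable fun q : 𝓥 × 𝓨 => g (r q.1, q.2)
      fun_prop
    refine Measure.ext_of_lintegral _ fun F hF => ?_
    rw [lintegral_compProd_densityKernel hmd hF, hlint F hF]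
    refine lintegral_congr_ae ?_
    filter_upwards [hone] with v hv
    simp [r, hv]

/-- The true conditional density is optimal by Gibbs' inequality. When its loss has infinite
positive part it may be inadmissible, but then every admissible rule has risk ⊤. -/
lemma bayesRisk_logLoss (hV : Measurable V) (hY : Measurable Y) {p : 𝓥 → ProbDensity μ}
    (hp : MeasurableDensity p)
    (hVY : P.map (fun ω => (V ω, Y ω)) = P.map V ⊗ₘ densityKernel p) :
    bayesRisk P (logLoss μ) Y V =
      riskOfParts (∫⁻ ω, logNeg ((p (V ω)).toFun (Y ω)) ∂P)
        (∫⁻ ω, logPos ((p (V ω)).toFun (Y ω)) ∂P) := by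
  have : IsProbabilityMeasure (P.map V) := Measure.isProbabilityMeasure_map hV.aemeasurable
  have hVYm : Measurable fun ω => (V ω, Y ω) := hV.prodMk hY
  have hexp : ∀ ψ : 𝓥 → ProbDensity μ, expectation P (fun ω => logLoss μ (Y ω) (ψ (V ω))) =
      ((∫⁻ ω, logNeg ((ψ (V ω)).toFun (Y ω)) ∂P : ℝ≥0∞) : EReal) -
        ((∫⁻ ω, logPos ((ψ (V ω)).toFun (Y ω)) ∂P : ℝ≥0∞) : EReal) := by
    intro ψ
    simp only [expectation, logLoss, neg_neg, logPos, logNeg]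
  refine le_antisymm ?_ ?_
  · rw [riskOfParts]
    split_ifs with ha
    · exact le_top
    refine iInf_le_of_le p (iInf_le_of_le ?_ (iInf_le_of_le (.inl ha) (hexp p).le))
    exact (ENNReal.measurable_log.comp hp.uncurry).neg
  · refine le_iInf fun ψ => le_iInf fun hψ => le_iInf fun hdef => ?_
    -- Measurability is assumed for the loss; applying exp to its negative recovers it for the
    -- density.
    have hψ' : MeasurableDensity ψ := by
      have h1 : Measurable fun q : 𝓥 × 𝓨 => ((ψ q.1).toFun q.2 : ℝ≥0∞) := by
        simpa [logLoss, Function.comp_def] using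
          EReal.measurable_exp.comp (measurable_neg.comp hψ)
      exact h1.ennreal_toNNReal
    rw [hexp]
    refine ExcessLossParts.riskOfParts_le (excessLossParts (P := P)
      (p := fun ω => (p (V ω)).toFun (Y ω)) (q := fun ω => (ψ (V ω)).toFun (Y ω))
      (Measurable.comp hp hVYm) (Measurable.comp hψ' hVYm) ?_ ?_) ?_
    · have h := density_ne_zero_ae (ρ := P.map V) hp
      rw [← hVY] at h
      exact ae_of_ae_map hVYm.aemeasurable h
    · have h := lintegral_ratio_le_one (ρ := P.map V) hp hψ'
      rwa [← hVY, lintegral_map (f := fun z : 𝓥 × 𝓨 =>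
        ((ψ z.1).toFun z.2 : ℝ≥0∞) / (p z.1).toFun z.2) (hψ'.uncurry.div hp.uncurry) hVYm] at h
    · simpa only [ExpectationDefined, logLoss, neg_neg, logPos, logNeg] using hdef

end Disintegration

lemma map_compProd_comap {𝓢 𝓡 𝓨 : Type*} [MeasurableSpace 𝓢] [MeasurableSpace 𝓡]
    [MeasurableSpace 𝓨] {f : 𝓢 → 𝓡} (hf : Measurable f) (ρ : Measure 𝓢) [SFinite ρ]
    (κ : Kernel 𝓡 𝓨) [IsSFiniteKernel κ] :
    (ρ ⊗ₘ κ.comap f hf).map (fun p => (f p.1, p.2)) = ρ.map f ⊗ₘ κ := by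
  refine Measure.ext_of_lintegral _ fun g hg => ?_
  rw [lintegral_map hg (by fun_prop), Measure.lintegral_compProd (by fun_prop),
    Measure.lintegral_compProd hg, lintegral_map (by fun_prop) hf]
  simp

lemma map_absolutelyContinuous_prod {Ω 𝓥 𝓨 : Type*} [MeasurableSpace Ω] [MeasurableSpace 𝓥]
    [MeasurableSpace 𝓨] {P : Measure Ω} [IsProbabilityMeasure P] {V : Ω → 𝓥} {Y : Ω → 𝓨}
    {μ : Measure 𝓨} [SigmaFinite μ] {η : Kernel 𝓥 𝓨}
    (h : P.map (fun ω => (V ω, Y ω)) = P.map V ⊗ₘ η) (hη : ∀ᵐ v ∂(P.map V), η v ≪ μ) :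
    P.map (fun ω => (V ω, Y ω)) ≪ (P.map V).prod μ := by
  rw [h, ← Measure.compProd_const]
  exact Measure.AbsolutelyContinuous.compProd_right (by simpa using hη)

-- Minimum excess risk as conditional information

section Model

variable {Ω 𝓦 𝓧 𝓨 : Type*} [MeasurableSpace Ω]
  [MeasurableSpace 𝓦] [StandardBorelSpace 𝓦] [Nonempty 𝓦]
  [MeasurableSpace 𝓧] [StandardBorelSpace 𝓧]
  [MeasurableSpace 𝓨] [StandardBorelSpace 𝓨] [Nonempty 𝓨]
  {prior : Measure 𝓦} [IsProbabilityMeasure prior]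
  {κ : Kernel 𝓦 (𝓧 × 𝓨)} [IsMarkovKernel κ] {n : ℕ}
  {P : Measure Ω} [IsProbabilityMeasure P]
  {W : Ω → 𝓦} {D : Ω → Fin n → 𝓧 × 𝓨} {X : Ω → 𝓧} {Y : Ω → 𝓨}
  {μ : Measure 𝓨} [SigmaFinite μ]

omit [StandardBorelSpace 𝓦] [Nonempty 𝓦] in
/-- A density of `P_{Y|X,W}` is also a density of `P_{Y|X,Zⁿ,W}`. -/
lemma map_eq_compProd_densityKernel (hW : Measurable W) (hD : Measurable D)
    (hX : Measurable X) (hY : Measurable Y)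
    (hlaw : P.map (fun ω => (W ω, (D ω, (X ω, Y ω)))) = jointLaw prior κ n)
    {p : 𝓧 × 𝓦 → ProbDensity μ} (hp : MeasurableDensity p)
    (hpY : P.map (fun ω => ((X ω, W ω), Y ω)) =
      P.map (fun ω => (X ω, W ω)) ⊗ₘ densityKernel p) :
    P.map (fun ω => (((X ω, D ω), W ω), Y ω)) = P.map (fun ω => ((X ω, D ω), W ω)) ⊗ₘ
      densityKernel fun s : (𝓧 × (Fin n → 𝓧 × 𝓨)) × 𝓦 => p (s.1.1, s.2) := by
  have := isMarkovKernel_densityKernel hp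
  have : IsProbabilityMeasure (P.map fun ω => (X ω, W ω)) :=
    Measure.isProbabilityMeasure_map (by fun_prop)
  have : IsProbabilityMeasure (P.map fun ω => ((X ω, D ω), W ω)) :=
    Measure.isProbabilityMeasure_map (by fun_prop)
  have hproj : Measurable fun s : (𝓧 × (Fin n → 𝓧 × 𝓨)) × 𝓦 => (s.1.1, s.2) := by fun_prop
  let k : Kernel (𝓧 × 𝓦) 𝓨 := κ.condKernel.comap Prod.swap measurable_swap
  have hk : P.map (fun ω => (((X ω, D ω), W ω), Y ω)) =
      P.map (fun ω => ((X ω, D ω), W ω)) ⊗ₘ k.comap (fun s => (s.1.1, s.2)) hproj :=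
    map_eq_compProd_condKernel hW hD hX hY hlaw
  have hmarg : P.map (fun ω => (X ω, W ω)) =
      (P.map fun ω => ((X ω, D ω), W ω)).map fun s => (s.1.1, s.2) := by
    rw [Measure.map_map hproj (by fun_prop)]
    rfl
  have hk' : P.map (fun ω => ((X ω, W ω), Y ω)) = P.map (fun ω => (X ω, W ω)) ⊗ₘ k := by
    rw [hmarg, ← map_compProd_comap hproj, ← hk, Measure.map_map (by fun_prop) (by fun_prop)]
    rfl
  -- Both kernels disintegrate the law of ((X,W),Y), so they agree almost everywhere.
  have hae : k =ᵐ[P.map fun ω => (X ω, W ω)] densityKernel p :=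
    Kernel.ae_eq_of_compProd_eq (hk'.symm.trans hpY)
  rw [hk, ← densityKernel_comap hp hproj]
  refine Measure.compProd_congr ?_
  rw [hmarg] at hae
  filter_upwards [ae_of_ae_map hproj.aemeasurable hae] with s hs
  exact hs

/-- Under log loss the minimum excess risk is the conditional mutual information. -/
lemma minExcessRisk_logLoss (hW : Measurable W) (hD : Measurable D)
    (hX : Measurable X) (hY : Measurable Y)
    (hlaw : P.map (fun ω => (W ω, (D ω, (X ω, Y ω)))) = jointLaw prior κ n)
    (hac : ∀ᵐ v ∂(P.map fun ω => (X ω, W ω)), condDistrib Y (fun ω => (X ω, W ω)) P v ≪ μ)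
    (htop : ¬ (bayesRisk P (logLoss μ) Y (fun ω => (X ω, D ω)) = ⊤ ∧
      bayesRisk P (logLoss μ) Y (fun ω => (X ω, W ω)) = ⊤))
    (hbot : ¬ (bayesRisk P (logLoss μ) Y (fun ω => (X ω, D ω)) = ⊥ ∧
      bayesRisk P (logLoss μ) Y (fun ω => (X ω, W ω)) = ⊥)) :
    minExcessRisk P (logLoss μ) W X Y D =
      ((condMutualInfo P W Y (fun ω => (X ω, D ω)) : ℝ≥0∞) : EReal) := by
  have hT : Measurable fun ω => (X ω, D ω) := hX.prodMk hD
  have hTW : Measurable fun ω => ((X ω, D ω), W ω) := hT.prodMk hW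
  have hTWY : Measurable fun ω => (((X ω, D ω), W ω), Y ω) := hTW.prodMk hY
  have : IsProbabilityMeasure (P.map fun ω => ((X ω, D ω), W ω)) :=
    Measure.isProbabilityMeasure_map (by fun_prop)
  obtain ⟨p, hp, hpY⟩ := exists_measurableDensity (hX.prodMk hW) hY
    (map_absolutelyContinuous_prod
      (map_prodMk_eq_compProd_condDistrib (P := P) (T := fun ω => (X ω, W ω)) hY) hac)
  have hp' : MeasurableDensity fun s : (𝓧 × (Fin n → 𝓧 × 𝓨)) × 𝓦 => p (s.1.1, s.2) :=
    hp.comp (by fun_prop)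
  have hpY' := map_eq_compProd_densityKernel hW hD hX hY hlaw hp hpY
  -- Domination survives projecting W away.
  have hacT : P.map (fun ω => ((X ω, D ω), Y ω)) ≪ (P.map fun ω => (X ω, D ω)).prod μ := by
    have h1 : P.map (fun ω => (((X ω, D ω), W ω), Y ω)) ≪
        (P.map fun ω => ((X ω, D ω), W ω)).prod μ := by
      refine map_absolutelyContinuous_prod hpY' (ae_of_all _ fun s => ?_)
      rw [densityKernel_apply hp']
      exact withDensity_absolutelyContinuous _ _
    have h2 := h1.map (f := Prod.map Prod.fst id) (by fun_prop)
    rw [Measure.map_map (by fun_prop) hTWY, ← Measure.map_prod_map _ _ measurable_fst measurable_id,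
      Measure.map_map measurable_fst hTW, Measure.map_id] at h2
    exact h2
  obtain ⟨q, hq, hqY⟩ := exists_measurableDensity hT hY hacT
  have hq' : MeasurableDensity fun s : (𝓧 × (Fin n → 𝓧 × 𝓨)) × 𝓦 => q s.1 :=
    hq.comp (by fun_prop)
  have := isMarkovKernel_densityKernel hq
  have hq0 : ∀ᵐ ω ∂P, (q (X ω, D ω)).toFun (Y ω) ≠ 0 := by
    have : IsProbabilityMeasure (P.map fun ω => (X ω, D ω)) :=
      Measure.isProbabilityMeasure_map (by fun_prop)
    have h := density_ne_zero_ae (ρ := P.map fun ω => (X ω, D ω)) hq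
    rw [← hqY] at h
    exact ae_of_ae_map (hT.prodMk hY).aemeasurable h
  have hp0 : ∀ᵐ ω ∂P, (p (X ω, W ω)).toFun (Y ω) ≠ 0 := by
    have h := density_ne_zero_ae (ρ := P.map fun ω => ((X ω, D ω), W ω)) hp'
    rw [← hpY'] at h
    exact ae_of_ae_map hTWY.aemeasurable h
  -- To be compared, p and q are both viewed as densities given (X,Zⁿ,W).
  have hratio := lintegral_ratio_le_one (ρ := P.map fun ω => ((X ω, D ω), W ω)) hp' hq'
  rw [← hpY', lintegral_map (f := fun z : ((𝓧 × (Fin n → 𝓧 × 𝓨)) × 𝓦) × 𝓨 =>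
    ((q z.1.1).toFun z.2 : ℝ≥0∞) / (p (z.1.1.1, z.1.2)).toFun z.2)
    (hq'.uncurry.div hp'.uncurry) hTWY] at hratio
  have hparts := excessLossParts (P := P) (p := fun ω => (p (X ω, W ω)).toFun (Y ω))
    (q := fun ω => (q (X ω, D ω)).toFun (Y ω))
    (Measurable.comp hp ((hX.prodMk hW).prodMk hY)) (Measurable.comp hq (hT.prodMk hY)) hp0 hratio
  have hrisk2 := bayesRisk_logLoss (hX.prodMk hW) hY hp hpY
  have hrisk1 := bayesRisk_logLoss hT hY hq hqY
  rw [hrisk1, hrisk2] at htop hbot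
  rw [minExcessRisk, hrisk1, hrisk2, hparts.riskOfParts_sub htop hbot,
    condMutualInfo_eq_klDiv_compProd hW hY hT hqY, hpY']
  have hqk : (densityKernel q).prodMkRight 𝓦 =
      densityKernel fun s : (𝓧 × (Fin n → 𝓧 × 𝓨)) × 𝓦 => q s.1 :=
    densityKernel_comap hq measurable_fst
  have hmeas : Measurable fun z : ((𝓧 × (Fin n → 𝓧 × 𝓨)) × 𝓦) × 𝓨 =>
      ((q z.1.1).toFun z.2 : ℝ≥0∞) / (p (z.1.1.1, z.1.2)).toFun z.2 :=
    hq'.uncurry.div hp'.uncurry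
  have hc := lintegral_map (μ := P) (measurable_logNeg.comp hmeas) hTWY
  have hd := lintegral_map (μ := P) (measurable_logPos.comp hmeas) hTWY
  simp only [Function.comp_apply] at hc hd
  rw [hqk, klDiv_compProd_densityKernel hp' hq', ← hpY', hc, hd]
  · rw [← hpY']
    exact (ae_map_iff hTWY.aemeasurable
      ((measurableSet_eq_fun hq' measurable_const).compl)).mpr hq0
  · rw [← hpY', hd]
    exact ne_top_of_le_ne_top ENNReal.one_ne_top hparts.gap_neg_le_one

end Model

end BayesLearning

theorem mainTheorem2 {Ω 𝓦 𝓧 𝓨 : Type*} [MeasurableSpace Ω]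
    [MeasurableSpace 𝓦] [StandardBorelSpace 𝓦] [Nonempty 𝓦]
    [MeasurableSpace 𝓧] [StandardBorelSpace 𝓧]
    [MeasurableSpace 𝓨] [StandardBorelSpace 𝓨] [Nonempty 𝓨]
    (prior : Measure 𝓦) [IsProbabilityMeasure prior]
    (κ : Kernel 𝓦 (𝓧 × 𝓨)) [IsMarkovKernel κ] (n : ℕ)
    (P : Measure Ω) [IsProbabilityMeasure P]
    (W : Ω → 𝓦) (Xs : Fin n → Ω → 𝓧) (Ys : Fin n → Ω → 𝓨) (X : Ω → 𝓧) (Y : Ω → 𝓨)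
    (hW : Measurable W) (hXs : ∀ i, Measurable (Xs i)) (hYs : ∀ i, Measurable (Ys i))
    (hX : Measurable X) (hY : Measurable Y)
    (hlaw : P.map (fun ω => (W ω, ((fun i => (Xs i ω, Ys i ω)), (X ω, Y ω)))) =
      BayesLearning.jointLaw prior κ n) :
    -- `MER_log = I(W;Y|X,Zⁿ)` whenever `P_{Y|X,W}` has densities and the difference is defined
    (∀ (μ : Measure 𝓨) [SigmaFinite μ],
      (∀ᵐ v ∂(P.map fun ω => (X ω, W ω)), condDistrib Y (fun ω => (X ω, W ω)) P v ≪ μ) →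
      ¬ (BayesLearning.bayesRisk P (BayesLearning.logLoss μ) Y
            (fun ω => (X ω, fun i => (Xs i ω, Ys i ω))) = ⊤ ∧
          BayesLearning.bayesRisk P (BayesLearning.logLoss μ) Y (fun ω => (X ω, W ω)) = ⊤) →
      ¬ (BayesLearning.bayesRisk P (BayesLearning.logLoss μ) Y
            (fun ω => (X ω, fun i => (Xs i ω, Ys i ω))) = ⊥ ∧
          BayesLearning.bayesRisk P (BayesLearning.logLoss μ) Y (fun ω => (X ω, W ω)) = ⊥) →
      BayesLearning.minExcessRisk P (BayesLearning.logLoss μ) W X Y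
          (fun ω i => (Xs i ω, Ys i ω)) =
        ((BayesLearning.condMutualInfo P W Y
          (fun ω => (X ω, fun i => (Xs i ω, Ys i ω))) : ℝ≥0∞) : EReal)) ∧
    -- `I(W;Y|X,Zⁿ) ≤ (1/n) I(W;Yⁿ|Xⁿ)` and `I(W;Y|X,Zⁿ) ≤ (1/n) I(W;Zⁿ)`
    (1 ≤ n →
      BayesLearning.condMutualInfo P W Y (fun ω => (X ω, fun i => (Xs i ω, Ys i ω))) ≤
          (n : ℝ≥0∞)⁻¹ *
            BayesLearning.condMutualInfo P W (fun ω i => Ys i ω) (fun ω i => Xs i ω) ∧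
      BayesLearning.condMutualInfo P W Y (fun ω => (X ω, fun i => (Xs i ω, Ys i ω))) ≤
          (n : ℝ≥0∞)⁻¹ *
            BayesLearning.mutualInfo P W (fun ω i => (Xs i ω, Ys i ω))) := by
  have hD : Measurable fun ω i => (Xs i ω, Ys i ω) :=
    measurable_pi_lambda _ fun i => (hXs i).prodMk (hYs i)
  have : Nonempty 𝓧 := P.nonempty_of_neZero.map X
  refine ⟨fun μ _ hac htop hbot =>
    BayesLearning.minExcessRisk_logLoss hW hD hX hY hlaw hac htop hbot, fun hn => ?_⟩
  have h := BayesLearning.condMutualInfo_le_inv_mul hW hXs hYs hX hY hlaw hn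
  exact ⟨h, h.trans (mul_le_mul_right
    (BayesLearning.condMutualInfo_outputs_le_mutualInfo hW hXs hYs) _)⟩
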